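/- An *alternating sign matrix* (ASM) of size $n$ is an $n\times n$ matrix $B=(b_{i,j})$ with entries in $\{-1,0,1\}$ such that every row and every column sums to $1$ and the nonzero entries of every row and column alternate in sign (equivalently, each row and column sums to $1$, and all partial row sums $\sum_{j\le k}b_{i,j}$ and partial column sums $\sum_{i\le k}b_{i,j}$ lie in $\{0,1\}$). Let $N(B)$ be the number of entries of $B$ equal to $-1$, let $$\mathrm{Inv}(B)=\sum_{1\le i<j\le n,\ 1\le k<\ell\le n} b_{i,\ell}\,b_{j,k}$$ (one has $\mathrm{Inv}(B)\ge N(B)$), and put $$Z^{(n)}_{ASM}(x,y)=\sum_{B\ \text{an ASM of size } n} x^{N(B)}\,y^{\mathrm{Inv}(B)-N(B)}.$$ A *descending plane partition* (DPP) is an array of positive integers $a_{i,j}$, called parts, with $1\le i\le r$ and $i\le j\le\mu_i$, where $r\ge 0$, $\mu_i\ge i$ and $\mu_1\ge\mu_2\ge\cdots\ge\mu_r$, such that, with $\lambda_i=\mu_i-i+1$ (the number of parts in row $i$) and $\lambda_0=\infty$, $$a_{i,j}\ge a_{i,j+1},\qquad a_{i,j}>a_{i+1,j},\qquad \lambda_i<a_{i,i}\le\lambda_{i-1}$$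 whenever the parts involved exist. The empty array ($r=0$) is a DPP. A DPP has *order* $n$ if all its parts are at most $n$. A part $a_{i,j}$ is *special* if $a_{i,j}\le j-i$. Put $$Z^{(n)}_{DPP}(x,y)=\sum_{D\ \text{a DPP of order } n} x^{s(D)}\,y^{t(D)},$$ where $s(D)$ is the number of special parts of $D$ and $t(D)$ is the number of its other parts. Then for every integer $n\ge 0$, and all elements $x,y$ of an arbitrary commutative ring (equivalently, as polynomials in two indeterminates $x,y$), $$Z^{(n)}_{ASM}(x,y)=Z^{(n)}_{DPP}(x,y).$$ -/

import Mathlib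

/-- `B` is an alternating sign matrix: entries in `{-1, 0, 1}`, every row and column sums to `1`,
and every partial row sum (from the left) and partial column sum (from the top) is `0` or `1`
(equivalently, the nonzero entries of each row and each column alternate in sign, and their
sum is `1`). -/
structure IsASM {n : ℕ} (B : Matrix (Fin n) (Fin n) ℤ) : Prop where
  entry : ∀ i j, B i j = -1 ∨ B i j = 0 ∨ B i j = 1
  row_sum : ∀ i, ∑ j, B i j = 1
  col_sum : ∀ j, ∑ i, B i j = 1
  row_partial : ∀ i k, 0 ≤ ∑ j ∈ Finset.Iic k, B i j ∧ ∑ j ∈ Finset.Iic k, B i j ≤ 1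
  col_partial : ∀ j k, 0 ≤ ∑ i ∈ Finset.Iic k, B i j ∧ ∑ i ∈ Finset.Iic k, B i j ≤ 1

/-- The number `N(B)` of entries `-1`. -/
def asmNegCount {n : ℕ} (B : Matrix (Fin n) (Fin n) ℤ) : ℕ :=
  (Finset.univ.filter fun p : Fin n × Fin n => B p.1 p.2 = -1).card

/-- The inversion number `Inv(B) = ∑_{i < j, k < l} B_{i,l} B_{j,k}`. -/
def asmInv {n : ℕ} (B : Matrix (Fin n) (Fin n) ℤ) : ℤ :=
  ∑ i, ∑ j ∈ Finset.Ioi i, ∑ k, ∑ l ∈ Finset.Ioi k, B i l * B j k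

/-- There are finitely many alternating sign matrices of a given size. -/
theorem finite_asm (n : ℕ) : {B : Matrix (Fin n) (Fin n) ℤ | IsASM B}.Finite := by
  have h : (Set.pi Set.univ fun _ : Fin n => Set.pi Set.univ fun _ : Fin n =>
      ({-1, 0, 1} : Set ℤ)).Finite :=
    Set.Finite.pi fun _ => Set.Finite.pi fun _ => Set.toFinite _
  refine h.subset fun B hB i _ j _ => ?_
  simpa using hB.entry i j

/-- The exponent `Inv(B) - N(B)` of an alternating sign matrix is nonnegative, so that no
truncation happens in `asmPartition`. -/
theorem asmNegCount_le_asmInv {n : ℕ} {B : Matrix (Fin n) (Fin n) ℤ} (hB : IsASM B) :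
    (asmNegCount B : ℤ) ≤ asmInv B := by
  have hN : (asmNegCount B : ℤ) = ∑ l, ∑ i, if B i l = -1 then 1 else 0 := by
    rw [asmNegCount, Finset.card_filter, Fintype.sum_prod_type_right]
    push_cast
    rfl
  have hcol : ∀ l, ∑ j, ∑ i ∈ Finset.Iio j, B i l * B j l =
      -∑ i, (if B i l = -1 then (1 : ℤ) else 0) := by
    intro l
    have h1 : (∑ i, B i l) * (∑ j, B j l) = 2 * (∑ j, ∑ i ∈ Finset.Iio j, B i l * B j l)
        + ∑ j, B j l * B j l := by
      have hs : ∑ j, ∑ i ∈ Finset.Ioi j, B i l * B j l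
          = ∑ j, ∑ i ∈ Finset.Iio j, B i l * B j l := by
        rw [Finset.sum_comm' (t' := Finset.univ) (s' := fun i => Finset.Iio i) (by simp)]
        simp only [mul_comm]
      rw [Finset.sum_mul_sum, Finset.sum_comm, two_mul]
      conv_rhs => enter [1, 2]; rw [← hs]
      rw [← Finset.sum_add_distrib, ← Finset.sum_add_distrib]
      refine Finset.sum_congr rfl fun j _ => ?_
      have hu : (Finset.univ : Finset (Fin n)) =
          (Finset.Iio j ∪ Finset.Ioi j) ∪ {j} := by
        ext i
        simp only [Finset.mem_univ, Finset.mem_union, Finset.mem_Iio, Finset.mem_Ioi,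
          Finset.mem_singleton, true_iff]
        rcases lt_trichotomy i j with h | h | h <;> simp [h]
      rw [hu, Finset.sum_union (by simp), Finset.sum_union, Finset.sum_singleton]
      rw [Finset.disjoint_left]
      intro i hi hi'
      exact absurd (Finset.mem_Iio.1 hi) (not_lt.2 (Finset.mem_Ioi.1 hi').le)
    have h2 : ∑ j, B j l * B j l = ∑ j, B j l + 2 * ∑ i, (if B i l = -1 then (1 : ℤ) else 0) := by
      rw [Finset.mul_sum, ← Finset.sum_add_distrib]
      refine Finset.sum_congr rfl fun j _ => ?_
      rcases hB.entry j l with h | h | h <;> simp [h]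
    rw [h2, hB.col_sum] at h1
    linarith
  have hpos : 0 ≤ ∑ j, ∑ l, (∑ k ∈ Finset.Iic l, B j k) * (∑ i ∈ Finset.Iio j, B i l) := by
    refine Finset.sum_nonneg fun j _ => Finset.sum_nonneg fun l _ =>
      mul_nonneg (hB.row_partial j l).1 ?_
    by_cases hj : (j : ℕ) = 0
    · rw [Finset.sum_eq_zero]
      intro i hi
      have := Fin.lt_def.1 (Finset.mem_Iio.1 hi)
      omega
    · have : Finset.Iio j = Finset.Iic (⟨j - 1, by omega⟩ : Fin n) := by
        ext i
        simp only [Finset.mem_Iio, Finset.mem_Iic, Fin.lt_def, Fin.le_def]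
        omega
      rw [this]
      exact (hB.col_partial l _).1
  have hsum : ∑ j, ∑ l, (∑ k ∈ Finset.Iic l, B j k) * (∑ i ∈ Finset.Iio j, B i l)
      = asmInv B + ∑ l, ∑ j, ∑ i ∈ Finset.Iio j, B i l * B j l := by
    have e1 : asmInv B = ∑ j, ∑ l, ∑ k ∈ Finset.Iio l, ∑ i ∈ Finset.Iio j, B i l * B j k := by
      rw [asmInv, Finset.sum_comm' (t' := Finset.univ) (s' := fun j => Finset.Iio j) (by simp)]
      refine Finset.sum_congr rfl fun j _ => ?_
      have : ∀ i, ∑ k, ∑ l ∈ Finset.Ioi k, B i l * B j k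
          = ∑ l, ∑ k ∈ Finset.Iio l, B i l * B j k := fun i =>
        Finset.sum_comm' (by simp)
      simp only [this]
      rw [Finset.sum_comm]
      exact Finset.sum_congr rfl fun l _ => Finset.sum_comm
    rw [e1, Finset.sum_comm (f := fun l j => ∑ i ∈ Finset.Iio j, B i l * B j l),
      ← Finset.sum_add_distrib]
    refine Finset.sum_congr rfl fun j _ => ?_
    rw [← Finset.sum_add_distrib]
    refine Finset.sum_congr rfl fun l _ => ?_
    rw [← Finset.Iio_insert, Finset.sum_insert (by simp), add_mul, Finset.sum_mul_sum,
      Finset.mul_sum, add_comm]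
    simp only [mul_comm]
  rw [hsum, Finset.sum_congr rfl fun l _ => hcol l, Finset.sum_neg_distrib, ← hN] at hpos
  linarith

/-- The refined partition function of alternating sign matrices of size `n`,
`∑_B x ^ N(B) * y ^ (Inv(B) - N(B))`. -/
noncomputable def asmPartition {R : Type*} [CommRing R] (n : ℕ) (x y : R) : R :=
  ∑ B ∈ (finite_asm n).toFinset, x ^ asmNegCount B * y ^ (asmInv B - asmNegCount B).toNat

/-- The number of parts of row `i` (rows counted from `0`) of an array given by the list of its
rows. -/
def dppRowLen (D : List (List ℕ)) (i : ℕ) : ℕ := (D.getD i []).length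

/-- The `k`-th entry (counted from `0`) of row `i` (counted from `0`). Row `i` of the shifted array
starts on the diagonal, so this is the entry in column `i + k`. -/
def dppPart (D : List (List ℕ)) (i k : ℕ) : ℕ := (D.getD i []).getD k 0

/-- `D`, the list of the rows of a shifted array, is a descending plane partition. The empty array
is one. -/
structure IsDPP (D : List (List ℕ)) : Prop where
  /-- every row has a part -/
  row_nonempty : ∀ i < D.length, 0 < dppRowLen D i
  /-- parts are positive -/
  part_pos : ∀ i < D.length, ∀ k < dppRowLen D i, 0 < dppPart D i k
  /-- no row reaches further to the right than the row above it -/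
  shape : ∀ i, i + 1 < D.length → dppRowLen D (i + 1) + 1 ≤ dppRowLen D i
  /-- rows decrease weakly -/
  row_anti : ∀ i < D.length, ∀ k, k + 1 < dppRowLen D i → dppPart D i (k + 1) ≤ dppPart D i k
  /-- columns decrease strictly: columns `i + 1 + k` of rows `i` and `i + 1` are compared -/
  col_anti : ∀ i, i + 1 < D.length → ∀ k < dppRowLen D (i + 1), dppPart D (i + 1) k < dppPart D i (k + 1)
  /-- the first part of a row exceeds the number of parts of that row -/
  len_lt_first : ∀ i < D.length, dppRowLen D i < dppPart D i 0
  /-- the first part of a row is at most the number of parts of the row above -/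
  first_le_len : ∀ i, i + 1 < D.length → dppPart D (i + 1) 0 ≤ dppRowLen D i

/-- `D` has order `n`: no part exceeds `n`. -/
def HasOrder (D : List (List ℕ)) (n : ℕ) : Prop :=
  ∀ i < D.length, ∀ k < dppRowLen D i, dppPart D i k ≤ n

/-- The number of special parts, the part in row `i` and column `j` being special when it is at
most `j - i`. -/
def specialCount (D : List (List ℕ)) : ℕ :=
  ∑ i ∈ Finset.range D.length, ((Finset.range (dppRowLen D i)).filter fun k => dppPart D i k ≤ k).card

/-- The number of parts that are not special. -/
def otherCount (D : List (List ℕ)) : ℕ :=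
  ∑ i ∈ Finset.range D.length, ((Finset.range (dppRowLen D i)).filter fun k => ¬ dppPart D i k ≤ k).card

/-- There are finitely many descending plane partitions of a given order. -/
theorem finite_dpp (n : ℕ) : {D : List (List ℕ) | IsDPP D ∧ HasOrder D n}.Finite := by
  have hbd : ∀ {α : Type} (s : Set α), s.Finite →
      {l : List α | l.length ≤ n ∧ ∀ a ∈ l, a ∈ s}.Finite := by
    intro α s hs
    have : Finite s := hs
    refine ((List.finite_length_le s n).image (List.map Subtype.val)).subset ?_
    rintro l ⟨hl, hm⟩
    exact ⟨l.attach.map fun a => ⟨a.1, hm a.1 a.2⟩, by simpa using hl, by simp⟩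
  refine (hbd _ (hbd _ (Set.finite_Iic n))).subset ?_
  rintro D ⟨hD, ho⟩
  have key : ∀ i < D.length, dppRowLen D i + i ≤ n := by
    intro i
    induction i with
    | zero =>
      intro h
      have h1 := hD.len_lt_first 0 h
      have h2 := ho 0 h 0 (hD.row_nonempty 0 h)
      omega
    | succ i ih =>
      intro h
      have h1 := ih (by omega)
      have h2 := hD.shape i h
      omega
  refine ⟨?_, fun row hrow => ?_⟩
  · rcases Nat.eq_zero_or_pos D.length with h | h
    · omega
    · have h1 := key (D.length - 1) (by omega)
      have h2 := hD.row_nonempty (D.length - 1) (by omega)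
      omega
  · obtain ⟨i, hi, rfl⟩ := List.getElem_of_mem hrow
    have hlen : dppRowLen D i = (D[i]).length := by simp [dppRowLen, hi]
    refine ⟨by have := key i hi; omega, fun a ha => ?_⟩
    obtain ⟨k, hk, rfl⟩ := List.getElem_of_mem ha
    have := ho i hi k (by omega)
    simpa [dppPart, hi, hk] using this

/-- The refined partition function of descending plane partitions of order `n`: weight `x` per
special part and `y` per other part. -/
noncomputable def dppPartition {R : Type*} [CommRing R] (n : ℕ) (x y : R) : R :=
  ∑ D ∈ (finite_dpp n).toFinset, x ^ specialCount D * y ^ otherCount D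

/-! Both sides are evaluated as one n × n determinant of power series coefficients. Parametrize x =
pq and y = (1 - p)(1 - q), so that p + q - 1 = x - y.

ASM side. Partial row and column sums identify alternating sign matrices with states of the
six-vertex model with domain wall boundary, and at zero spectral parameters the vertex weights
produce exactly the ASM weight (`dwbcPartition_zero_eq_asmPartition`). The inhomogeneous model
satisfies a Yang–Baxter equation, so its partition function is symmetric in the row parameters; it
has degree less than n in a column parameter, and it factors when `t 0 * s 0 = 1`. The determinant
of `ikMatrix` has the corresponding properties, and interpolation gives an Izergin–Korepin formula
(`dwbcPartition_mul_eq_det`). The column parameters are unrestricted there, so they are set to 0 at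
once; letting the row parameters tend to 0 turns the quotient by a Vandermonde determinant into a
determinant of coefficients (`dwbcPartition_zero_eq_det`).

DPP side. The row lengths interlace with the first parts, and so do successive diagonals with each
other. Each interlacing sum is a row operation on a determinant, so the partitions with prescribed
first parts are counted by a principal minor of the matrix of `dppEntry`
(`sum_dpp_length_eq_sum_det`). Summing all principal minors gives det(1 + M)
(`dppPartition_eq_det`). The path counts in M have generating series (1 - (x - y)X)^j / (1 -
xX)^(j+1) (`pow_mul_pathSeries`).

Multiplying the columns of the DPP determinant by (1 - xX)^n leaves it unchanged and yields the ASM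
determinant. This requires p and q, hence an algebraically closed field; evaluation over ℂ proves
the universal identity over ℤ, which specializes to every commutative ring. -/

/-! ### The six-vertex model and its Yang–Baxter equation. -/

/-- Weight of a vertex of the inhomogeneous six-vertex model with row parameter `t` and column
parameter `s`, as a function of its left, right, top and bottom edges. -/
def vertexWeight {R : Type*} [CommRing R] (p q t s : R) : Bool → Bool → Bool → Bool → R
  | false, false, false, false => 1 - t * s
  | true, true, true, true => (1 - p) * (1 - q) * (1 - t * s)
  | true, true, false, false => 1 - p * q * t - s + (p + q - 1) * (t * s)
  | false, false, true, true => 1 - p * q * t - s + (p + q - 1) * (t * s)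
  | false, true, false, true => 1 - q * t
  | true, false, true, false => (1 - p * t) * (p - s) * (q - s)
  | _, _, _, _ => 0

/-- The matrix intertwining two rows of vertices with parameters `t` and `t'`. -/
def rowIntertwiner {R : Type*} [CommRing R] (p q t t' : R) : Matrix (Bool × Bool) (Bool × Bool) R
  | (false, false), (false, false) => 1 - t' - (p + q - 1) * t + p * q * t * t'
  | (true, true), (true, true) => 1 - t' - (p + q - 1) * t + p * q * t * t'
  | (false, true), (false, true) => t - t'
  | (true, false), (true, false) => (1 - p) * (1 - q) * (t - t')
  | (false, true), (true, false) => (1 - p * t') * (1 - q * t)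
  | (true, false), (false, true) => (1 - p * t) * (1 - q * t')
  | _, _ => 0

/-- Transfer matrix of a row of vertices with given leftmost and rightmost edges. -/
def rowTransfer {R : Type*} [CommRing R] (p q t : R) :
    (n : ℕ) → (Fin n → R) → Bool → Bool → Matrix (Fin n → Bool) (Fin n → Bool) R
  | 0, _, l, r => Matrix.of fun _ _ => if l = r then 1 else 0
  | n + 1, s, l, r => Matrix.of fun σ τ => ∑ m, vertexWeight p q t (s 0) l m (σ 0) (τ 0) *
      rowTransfer p q t n (Fin.tail s) m r (Fin.tail σ) (Fin.tail τ)

/-- Two vertices on top of each other. -/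
def vertexPair {R : Type*} [CommRing R] (p q t t' s : R) (a c : Bool) :
    Matrix (Bool × Bool) (Bool × Bool) R :=
  Matrix.of fun l r => ∑ b, vertexWeight p q t s l.1 r.1 a b * vertexWeight p q t' s l.2 r.2 b c

/-- The Yang–Baxter equation for these weights: a polynomial identity for each of the 64 boundary
configurations. -/
theorem rowIntertwiner_mul_vertexPair {R : Type*} [CommRing R] (p q t t' s : R) (a c : Bool) :
    rowIntertwiner p q t t' * vertexPair p q t t' s a c =
      (vertexPair p q t' t s a c).submatrix Prod.swap Prod.swap * rowIntertwiner p q t t' := by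
  ext ⟨l, l'⟩ ⟨r, r'⟩
  simp only [Matrix.mul_apply, vertexPair, Matrix.of_apply, Matrix.submatrix_apply, Prod.swap,
    Fintype.sum_prod_type, Fintype.sum_bool]
  cases a <;> cases c <;> cases l <;> cases l' <;> cases r <;> cases r' <;>
    simp only [rowIntertwiner, vertexWeight] <;> ring

/-- Two rows of vertices on top of each other. -/
def rowPair {R : Type*} [CommRing R] (p q t t' : R) {n : ℕ} (s : Fin n → R)
    (σ τ : Fin n → Bool) : Matrix (Bool × Bool) (Bool × Bool) R :=
  Matrix.of fun l r =>
    (rowTransfer p q t n s l.1 r.1 * rowTransfer p q t' n s l.2 r.2) σ τ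

theorem sum_fin_succ_pi {α M : Type*} [Fintype α] [AddCommMonoid M] {n : ℕ}
    (f : (Fin (n + 1) → α) → M) : ∑ ρ, f ρ = ∑ b, ∑ ρ, f (Fin.cons b ρ) := by
  rw [← Fintype.sum_prod_type']
  exact (Fintype.sum_equiv (Fin.consEquiv fun _ => α) _ _ fun _ => rfl).symm

theorem rowPair_succ {R : Type*} [CommRing R] (p q t t' : R) {n : ℕ} (s : Fin (n + 1) → R)
    (σ τ : Fin (n + 1) → Bool) :
    rowPair p q t t' s σ τ =
      vertexPair p q t t' (s 0) (σ 0) (τ 0) *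
        rowPair p q t t' (Fin.tail s) (Fin.tail σ) (Fin.tail τ) := by
  ext ⟨l, l'⟩ ⟨r, r'⟩
  simp only [rowPair, Matrix.of_apply, Matrix.mul_apply, vertexPair, rowTransfer,
    sum_fin_succ_pi, Fintype.sum_prod_type, Fin.cons_zero, Fin.tail_cons]
  simp only [Fintype.sum_bool, Finset.mul_sum, ← Finset.sum_add_distrib]
  exact Finset.sum_congr rfl fun _ _ => by ring

/-- The intertwiner passes through the columns from left to right, exchanging `t` and `t'` in each
of them. -/
theorem rowIntertwiner_mul_rowPair {R : Type*} [CommRing R] (p q t t' : R) {n : ℕ} (s : Fin n → R)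
    (σ τ : Fin n → Bool) :
    rowIntertwiner p q t t' * rowPair p q t t' s σ τ =
      (rowPair p q t' t s σ τ).submatrix Prod.swap Prod.swap * rowIntertwiner p q t t' := by
  induction n with
  | zero =>
    have h : ∀ u u' : R, rowPair p q u u' s σ τ = 1 := by
      intro u u'
      ext ⟨l, l'⟩ ⟨r, r'⟩
      simp only [rowPair, Matrix.of_apply, rowTransfer, Matrix.mul_apply, Matrix.one_apply]
      cases l <;> cases l' <;> cases r <;> cases r' <;> simp
    rw [h, h, ← Equiv.coe_prodComm, Matrix.submatrix_one_equiv]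
    simp
  | succ n ih =>
    have h : ∀ A B : Matrix (Bool × Bool) (Bool × Bool) R,
        (A * B).submatrix Prod.swap Prod.swap =
          A.submatrix Prod.swap Prod.swap * B.submatrix Prod.swap Prod.swap := fun A B =>
      (Matrix.submatrix_mul_equiv A B Prod.swap (Equiv.prodComm _ _) Prod.swap).symm
    rw [rowPair_succ, ← Matrix.mul_assoc, rowIntertwiner_mul_vertexPair, Matrix.mul_assoc, ih,
      rowPair_succ, h, Matrix.mul_assoc]

/-- In the entry from `(false, false)` to `(true, true)` of the intertwining relation only the two
corner entries of the intertwiner survive. They are equal, and the hypothesis allows cancelling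
them. -/
theorem commute_rowTransfer {R : Type*} [CommRing R] [IsDomain R] (p q t t' : R) {n : ℕ}
    (s : Fin n → R) (h : 1 - t' - (p + q - 1) * t + p * q * t * t' ≠ 0) :
    Commute (rowTransfer p q t n s false true) (rowTransfer p q t' n s false true) := by
  ext σ τ
  have := congrFun (congrFun (rowIntertwiner_mul_rowPair p q t t' s σ τ) (false, false))
    (true, true)
  simp only [Matrix.mul_apply, Fintype.sum_prod_type, Fintype.sum_bool, rowIntertwiner, zero_mul,
    mul_zero, add_zero, zero_add, Matrix.submatrix_apply, Prod.swap, rowPair, Matrix.of_apply]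
    at this
  exact mul_left_cancel₀ h (this.trans (mul_comm _ _))

/-- Partition function of the six-vertex model with domain wall boundary conditions, for the list
`t` of row parameters and the column parameters `s`. -/
def dwbcPartition {R : Type*} [CommRing R] (p q : R) (t : List R) {n : ℕ} (s : Fin n → R) : R :=
  (t.map fun u => rowTransfer p q u n s false true).prod (fun _ => false) (fun _ => true)

/-! ### Frozen first row and column when the corner weight vanishes. -/

section FirstColumn

variable {R : Type*} [CommRing R] (p q : R) {n : ℕ} (s : Fin (n + 1) → R)

theorem rowTransfer_cons_false_false (u : R) (σ τ : Fin n → Bool) :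
    rowTransfer p q u (n + 1) s false true (Fin.cons false σ) (Fin.cons false τ) =
      (1 - u * s 0) * rowTransfer p q u n (Fin.tail s) false true σ τ := by
  simp [rowTransfer, vertexWeight]

theorem rowTransfer_cons_false_true (u : R) (σ τ : Fin n → Bool) :
    rowTransfer p q u (n + 1) s false true (Fin.cons false σ) (Fin.cons true τ) =
      (1 - q * u) * rowTransfer p q u n (Fin.tail s) true true σ τ := by
  simp [rowTransfer, vertexWeight]

theorem rowTransfer_cons_true_false (u : R) (σ τ : Fin n → Bool) :
    rowTransfer p q u (n + 1) s false true (Fin.cons true σ) (Fin.cons false τ) = 0 := by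
  simp [rowTransfer, vertexWeight]

theorem rowTransfer_cons_true_true (u : R) (σ τ : Fin n → Bool) :
    rowTransfer p q u (n + 1) s false true (Fin.cons true σ) (Fin.cons true τ) =
      (1 - p * q * u - s 0 + (p + q - 1) * (u * s 0)) *
        rowTransfer p q u n (Fin.tail s) false true σ τ := by
  simp [rowTransfer, vertexWeight]

/-- With left edges `false`, a first column entered by a `true` edge keeps it in every row, so the
column is frozen and splits off as a scalar. -/
theorem prod_rowTransfer_cons_true_true (t : List R) (σ τ : Fin n → Bool) :
    (t.map fun u => rowTransfer p q u (n + 1) s false true).prod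
        (Fin.cons true σ) (Fin.cons true τ) =
      (t.map fun u => 1 - p * q * u - s 0 + (p + q - 1) * (u * s 0)).prod *
        (t.map fun u => rowTransfer p q u n (Fin.tail s) false true).prod σ τ := by
  induction t generalizing σ with
  | nil =>
    simp [Matrix.one_apply, Fin.cons_right_injective (α := fun _ => Bool) _ |>.eq_iff]
  | cons u t ih =>
    simp only [List.map_cons, List.prod_cons, Matrix.mul_apply, sum_fin_succ_pi, Fintype.sum_bool,
      rowTransfer_cons_true_false, rowTransfer_cons_true_true, ih, Finset.mul_sum]
    simp only [zero_mul, Finset.sum_const_zero, add_zero]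
    exact Finset.sum_congr rfl fun _ _ => by ring

/-- A horizontal `true` edge can only turn at a vertex whose top edge is `true`; with all top edges
`false` it runs straight through. -/
theorem rowTransfer_true_true_false (u : R) {n : ℕ} (s : Fin n → R) (τ : Fin n → Bool) :
    rowTransfer p q u n s true true (fun _ => false) τ =
      if τ = (fun _ => false) then ∏ k, (1 - p * q * u - s k + (p + q - 1) * (u * s k)) else 0 := by
  induction n with
  | zero => simp [rowTransfer, Subsingleton.elim τ fun _ => false]
  | succ n ih =>
    have h : (Fin.tail fun _ : Fin (n + 1) => false) = fun _ => false := rfl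
    rw [rowTransfer, Matrix.of_apply]
    cases hτ : τ 0
    · have : τ = (fun _ => false) ↔ Fin.tail τ = fun _ => false := by
        constructor
        · rintro rfl; rfl
        · intro h'
          rw [← Fin.cons_self_tail τ, hτ, h']
          funext i
          cases i using Fin.cases <;> rfl
      simp only [Fintype.sum_bool, h, ih, this, vertexWeight, Fin.prod_univ_succ, Fin.tail]
      split_ifs <;> simp
    · have : τ ≠ fun _ => false := fun h' => by simp [h'] at hτ
      simp [vertexWeight, this]

/-- The corner vertex is either empty, with weight `1 - u * s 0 = 0`, or the turn of weight `1 - q *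
u`. The turn freezes the rest of the first row and of the first column, leaving a model smaller by
one. -/
theorem dwbcPartition_cons_of_mul_eq_one (u : R) (t : List R) (h : u * s 0 = 1) :
    dwbcPartition p q (u :: t) s =
      (1 - q * u) * (∏ k, (1 - p * q * u - Fin.tail s k + (p + q - 1) * (u * Fin.tail s k))) *
        (t.map fun u => 1 - p * q * u - s 0 + (p + q - 1) * (u * s 0)).prod *
          dwbcPartition p q t (Fin.tail s) := by
  have h0 : (fun _ => false : Fin (n + 1) → Bool) = Fin.cons false fun _ => false := by
    funext i; cases i using Fin.cases <;> rfl
  have h1 : (fun _ => true : Fin (n + 1) → Bool) = Fin.cons true fun _ => true := by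
    funext i; cases i using Fin.cases <;> rfl
  simp only [dwbcPartition]
  rw [h0, h1, List.map_cons, List.prod_cons, Matrix.mul_apply, sum_fin_succ_pi]
  simp only [Fintype.sum_bool, rowTransfer_cons_false_false, rowTransfer_cons_false_true, h,
    prod_rowTransfer_cons_true_true, rowTransfer_true_true_false]
  simp
  ring

end FirstColumn

/-! ### Degree in the first column parameter. -/

/-- `f` is given by a polynomial of degree less than `k`. -/
def IsPolyDegLT {R : Type*} [CommRing R] (k : ℕ) (f : R → R) : Prop :=
  ∃ P : Polynomial R, P.degree < k ∧ ∀ x, f x = P.eval x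

section PolyDeg

open Polynomial

variable {R : Type*} [CommRing R]

theorem IsPolyDegLT.const_mul {k : ℕ} {f : R → R} (hf : IsPolyDegLT k f) (c : R) :
    IsPolyDegLT k fun x => c * f x := by
  obtain ⟨P, hP, h⟩ := hf
  exact ⟨c • P, (degree_smul_le _ _).trans_lt hP, fun x => by simp [h]⟩

theorem IsPolyDegLT.sum {ι : Type*} {k : ℕ} {f : ι → R → R} (S : Finset ι)
    (hf : ∀ i ∈ S, IsPolyDegLT k (f i)) : IsPolyDegLT k fun x => ∑ i ∈ S, f i x := by
  classical
  induction S using Finset.induction_on with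
  | empty => exact ⟨0, by simp [degree_zero], by simp⟩
  | insert i S hi ih =>
    obtain ⟨P, hP, h⟩ := ih fun j hj => hf j (Finset.mem_insert_of_mem hj)
    obtain ⟨Q, hQ, h'⟩ := hf i (Finset.mem_insert_self _ _)
    refine ⟨Q + P, (degree_add_le _ _).trans_lt (max_lt hQ hP), fun x => ?_⟩
    simp [Finset.sum_insert hi, h, h']

theorem IsPolyDegLT.add {k : ℕ} {f g : R → R} (hf : IsPolyDegLT k f) (hg : IsPolyDegLT k g) :
    IsPolyDegLT k fun x => f x + g x := by
  obtain ⟨P, hP, h⟩ := hf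
  obtain ⟨Q, hQ, h'⟩ := hg
  exact ⟨P + Q, (degree_add_le _ _).trans_lt (max_lt hP hQ), fun x => by simp [h, h']⟩

theorem IsPolyDegLT.linear_mul {k : ℕ} {f : R → R} (hf : IsPolyDegLT k f) (a b : R) :
    IsPolyDegLT (k + 1) fun x => (a + b * x) * f x := by
  obtain ⟨P, hP, h⟩ := hf
  refine ⟨(C a + C b * X) * P, ?_, fun x => by simp [h]⟩
  rw [← mem_degreeLT] at hP
  by_cases hP0 : P = 0
  · simp [hP0]
  have hk : P.natDegree < k := (natDegree_lt_iff_degree_lt hP0).2 (mem_degreeLT.1 hP)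
  refine lt_of_le_of_lt degree_le_natDegree ?_
  norm_cast
  refine lt_of_le_of_lt natDegree_mul_le ?_
  have : (C a + C b * X).natDegree ≤ 1 := by
    rw [add_comm]; exact natDegree_linear_le
  omega

theorem isPolyDegLT_const (c : R) : IsPolyDegLT 1 fun _ => c :=
  ⟨C c, lt_of_le_of_lt degree_C_le (by norm_num), by simp⟩

/-- The first column changes from `false` to `true` in exactly one row. That vertex weight does not
involve `x`; those of the other rows are linear in `x`. -/
theorem isPolyDegLT_prod_rowTransfer (p q : R) {n : ℕ} (s : Fin n → R) (t : List R)
    (σ τ : Fin n → Bool) :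
    IsPolyDegLT t.length fun x =>
      (t.map fun u => rowTransfer p q u (n + 1) (Fin.cons x s : Fin (n + 1) → R) false true).prod
        (Fin.cons false σ) (Fin.cons true τ) := by
  induction t generalizing σ with
  | nil =>
    refine ⟨0, by simp [degree_zero], fun x => ?_⟩
    have : (Fin.cons false σ : Fin (n + 1) → Bool) ≠ Fin.cons true τ := fun h => by
      have := congrFun h 0
      simp at this
    simp [this]
  | cons u t ih =>
    have h1 : ∀ l : List R, IsPolyDegLT (l.length + 1) fun x =>
        (l.map fun u => 1 - p * q * u - x + (p + q - 1) * (u * x)).prod := by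
      intro l
      induction l with
      | nil => simpa using isPolyDegLT_const (1 : R)
      | cons v l ihl =>
        change IsPolyDegLT (l.length + 1 + 1) _
        convert ihl.linear_mul (1 - p * q * v) ((p + q - 1) * v - 1) using 2 with x
        rw [List.map_cons, List.prod_cons]
        ring
    simp only [List.map_cons, List.prod_cons, Matrix.mul_apply, sum_fin_succ_pi, Fintype.sum_bool,
      rowTransfer_cons_false_false, rowTransfer_cons_false_true, prod_rowTransfer_cons_true_true,
      Fin.cons_zero, Fin.tail_cons, List.length_cons]
    refine IsPolyDegLT.add (.sum _ fun ρ _ => ?_) (.sum _ fun ρ _ => ?_)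
    · convert (h1 t).const_mul ((1 - q * u) * rowTransfer p q u n s true true σ ρ *
        (t.map fun u => rowTransfer p q u n s false true).prod ρ τ) using 2 with x
      ring
    · convert ((ih ρ).const_mul (rowTransfer p q u n s false true σ ρ)).linear_mul 1 (-u)
        using 2 with x
      ring

theorem isPolyDegLT_dwbcPartition (p q : R) {n : ℕ} (s : Fin n → R) (t : List R) :
    IsPolyDegLT t.length fun x => dwbcPartition p q t (Fin.cons x s : Fin (n + 1) → R) := by
  have h0 : (fun _ => false : Fin (n + 1) → Bool) = Fin.cons false fun _ => false := by
    funext i; cases i using Fin.cases <;> rfl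
  have h1 : (fun _ => true : Fin (n + 1) → Bool) = Fin.cons true fun _ => true := by
    funext i; cases i using Fin.cases <;> rfl
  simp only [dwbcPartition]
  rw [h0, h1]
  exact isPolyDegLT_prod_rowTransfer p q s t _ _

/-- The `w m` are signed elementary symmetric polynomials in `s`. The homogeneous form matters: the
same `w` serves for every pair `(u, v)`, which is what makes it a kernel vector in
`isPolyDegLT_det_ikMatrix`. -/
theorem exists_prod_sub_eq_sum (n : ℕ) (s : Fin n → R) :
    ∃ w : ℕ → R, w n = 1 ∧ (∀ m, n < m → w m = 0) ∧
      ∀ u v : R, ∏ k, (u - v * s k) = ∑ m ∈ Finset.range (n + 1), w m * (u ^ m * v ^ (n - m)) := by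
  induction n with
  | zero => exact ⟨fun m => if m = 0 then 1 else 0, by simp, by simp; omega, by simp⟩
  | succ n ih =>
    obtain ⟨w, h1, h2, h3⟩ := ih (Fin.tail s)
    refine ⟨fun m => (if m = 0 then 0 else w (m - 1)) - s 0 * w m, by simp [h1, h2], ?_, ?_⟩
    · intro m hm
      simp only [if_neg (show m ≠ 0 by omega), h2 (m - 1) (by omega), h2 m (by omega)]
      simp
    · intro u v
      have h4 := h3 u v
      rw [Fin.prod_univ_succ]
      simp only [Fin.tail] at h4
      rw [h4]
      simp only [sub_mul, Finset.sum_sub_distrib]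
      congr 1
      · rw [Finset.sum_range_succ' _ (n + 1)]
        simp [Finset.mul_sum]
        refine Finset.sum_congr rfl fun m hm => ?_
        ring
      · rw [Finset.sum_range_succ _ (n + 1), h2 (n + 1) (by omega)]
        simp only [mul_zero, zero_mul, add_zero, Finset.mul_sum]
        refine Finset.sum_congr rfl fun m hm => ?_
        rw [show n + 1 - m = n - m + 1 by have := Finset.mem_range.1 hm; omega]
        ring

end PolyDeg

/-! ### The Izergin–Korepin determinant. -/

/-- The matrix in the determinant formula for the partition function of the six-vertex model with
domain wall boundary conditions. -/
def ikMatrix {R : Type*} [CommRing R] (p q : R) {n : ℕ} (t s : Fin n → R) :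
    Matrix (Fin n) (Fin n) R :=
  Matrix.of fun i m =>
    (1 - p * q * t i) ^ (m : ℕ) * (1 - (p + q - 1) * t i) ^ (n - m : ℕ) * ∏ k, (1 - t i * s k) -
      t i ^ (n - m : ℕ) * ∏ k, (1 - p * q * t i - (1 - (p + q - 1) * t i) * s k)

/-- Subtracting `s 0` times the preceding column produces the smaller matrix, with row factors
containing `1 - t i * s 0`. For `i = 0` this factor vanishes, so the first row keeps only its first
entry. -/
theorem det_ikMatrix_of_mul_eq_one {R : Type*} [CommRing R] (p q : R) {n : ℕ}
    (t s : Fin (n + 1) → R) (h : t 0 * s 0 = 1) :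
    (ikMatrix p q t s).det = (1 - p * t 0) * (1 - q * t 0) *
      (∏ k, (1 - p * q * t 0 - Fin.tail s k + (p + q - 1) * (t 0 * Fin.tail s k))) *
      (∏ j, ((t 0 - Fin.tail t j) *
        (1 - p * q * Fin.tail t j - s 0 + (p + q - 1) * (Fin.tail t j * s 0)))) *
      (ikMatrix p q (Fin.tail t) (Fin.tail s)).det := by
  let B : Matrix (Fin (n + 1)) (Fin (n + 1)) R := Matrix.of fun i m =>
    Fin.cases (ikMatrix p q t s i 0)
      (fun j => ikMatrix p q t s i j.succ - s 0 * ikMatrix p q t s i j.castSucc) m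
  have hB : (ikMatrix p q t s).det = B.det :=
    Matrix.det_eq_of_forall_col_eq_smul_add_pred (fun _ => s 0) (fun i => rfl)
      fun i j => by simp [B]
  have hBs : ∀ i (j : Fin n), B i j.succ =
      (1 - t i * s 0) * (1 - p * q * t i - (1 - (p + q - 1) * t i) * s 0) *
      ((1 - p * q * t i) ^ (j : ℕ) * (1 - (p + q - 1) * t i) ^ (n - j : ℕ) *
        ∏ k, (1 - t i * Fin.tail s k) -
      t i ^ (n - j : ℕ) * ∏ k, (1 - p * q * t i - (1 - (p + q - 1) * t i) * Fin.tail s k)) := by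
    intro i j
    have e1 : n + 1 - (j : ℕ) = n - j + 1 := by omega
    have e2 : n + 1 - ((j : ℕ) + 1) = n - j := by omega
    simp only [B, ikMatrix, Matrix.of_apply, Fin.cases_succ, Fin.val_succ, Fin.val_castSucc,
      Fin.prod_univ_succ, e1, e2, Fin.tail]
    ring
  have hB0 : B 0 0 = - (t 0 ^ (n + 1) *
      ∏ k, (1 - p * q * t 0 - (1 - (p + q - 1) * t 0) * s k)) := by
    simp [B, ikMatrix, Fin.prod_univ_succ, h]
  rw [hB, Matrix.det_succ_row_zero, Fin.sum_univ_succ, Finset.sum_eq_zero, hB0]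
  · have hsub : B.submatrix Fin.succ (Fin.succAbove 0) = Matrix.of fun i j =>
        ((1 - Fin.tail t i * s 0) *
          (1 - p * q * Fin.tail t i - s 0 + (p + q - 1) * (Fin.tail t i * s 0))) *
        ikMatrix p q (Fin.tail t) (Fin.tail s) i j := by
      ext i j
      simp only [Matrix.submatrix_apply, Fin.zero_succAbove, hBs, Matrix.of_apply, ikMatrix,
        Fin.tail]
      ring
    rw [hsub, Matrix.det_mul_column]
    -- Since `t 0 * s 0 = 1`, one has `t 0 - t j = t 0 * (1 - t j * s 0)`; this converts the row
    -- factors into the missing part of the Vandermonde product.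
    have h1 : ∏ j, (t 0 - Fin.tail t j) = t 0 ^ n * ∏ j, (1 - Fin.tail t j * s 0) := by
      have : ∏ _j : Fin n, t 0 = t 0 ^ n := by simp
      rw [← this, ← Finset.prod_mul_distrib]
      exact Finset.prod_congr rfl fun j _ => by linear_combination (Fin.tail t j) * h
    have h2 : t 0 * (1 - p * q * t 0 - (1 - (p + q - 1) * t 0) * s 0) =
        - ((1 - p * t 0) * (1 - q * t 0)) := by
      linear_combination (-(1 - (p + q - 1) * t 0)) * h
    have h3 : ∏ k : Fin n, (1 - p * q * t 0 - (1 - (p + q - 1) * t 0) * s k.succ) =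
        ∏ k, (1 - p * q * t 0 - Fin.tail s k + (p + q - 1) * (t 0 * Fin.tail s k)) :=
      Finset.prod_congr rfl fun k _ => by simp only [Fin.tail]; ring
    rw [Finset.prod_mul_distrib, Finset.prod_mul_distrib, h1, Fin.prod_univ_succ, h3, pow_succ]
    simp only [Fin.val_zero, pow_zero, one_mul, add_zero]
    set A := ∏ k, (1 - p * q * t 0 - Fin.tail s k + (p + q - 1) * (t 0 * Fin.tail s k))
    set B₁ := ∏ j, (1 - Fin.tail t j * s 0)
    set B₂ := ∏ j, (1 - p * q * Fin.tail t j - s 0 + (p + q - 1) * (Fin.tail t j * s 0))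
    linear_combination
      (-(t 0 ^ n * A * B₁ * B₂ * (ikMatrix p q (Fin.tail t) (Fin.tail s)).det)) * h2
  · intro j _
    rw [hBs, h]
    simp

/-- The matrix is `x • A + B`, so the degree is at most `n + 1` and the coefficient of that degree
is `A.det`. It vanishes because the coefficients of `∏ k, (X - s k)` form a kernel vector of `A`. -/
theorem isPolyDegLT_det_ikMatrix {R : Type*} [CommRing R] [IsDomain R] (p q : R) {n : ℕ}
    (t : Fin (n + 1) → R) (s : Fin n → R) :
    IsPolyDegLT (n + 1) fun x => (ikMatrix p q t (Fin.cons x s : Fin (n + 1) → R)).det := by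
  open Polynomial in
  let u : Fin (n + 1) → R := fun i => 1 - p * q * t i
  let v : Fin (n + 1) → R := fun i => 1 - (p + q - 1) * t i
  let P : Fin (n + 1) → R := fun i => ∏ k, (1 - t i * s k)
  let Q : Fin (n + 1) → R := fun i => ∏ k, (u i - v i * s k)
  let A : Matrix (Fin (n + 1)) (Fin (n + 1)) R := Matrix.of fun i m =>
    t i ^ (n + 1 - m : ℕ) * v i * Q i - u i ^ (m : ℕ) * v i ^ (n + 1 - m : ℕ) * t i * P i
  let B : Matrix (Fin (n + 1)) (Fin (n + 1)) R := Matrix.of fun i m =>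
    u i ^ (m : ℕ) * v i ^ (n + 1 - m : ℕ) * P i - t i ^ (n + 1 - m : ℕ) * u i * Q i
  have hA : A.det = 0 := by
    obtain ⟨w, h1, -, h3⟩ := exists_prod_sub_eq_sum n s
    refine Matrix.exists_mulVec_eq_zero_iff.1 ⟨fun m => w m, ?_, ?_⟩
    · intro h
      have := congrFun h (Fin.last n)
      simp [h1] at this
    · funext i
      have hP : P i = ∑ m : Fin (n + 1), w m * (1 ^ (m : ℕ) * t i ^ (n - m : ℕ)) :=
        (h3 1 (t i)).trans (Finset.sum_range _)
      have hQ : Q i = ∑ m : Fin (n + 1), w m * (u i ^ (m : ℕ) * v i ^ (n - m : ℕ)) :=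
        (h3 (u i) (v i)).trans (Finset.sum_range _)
      have : ∀ m : Fin (n + 1), A i m * w m =
          t i * v i * Q i * (w m * (1 ^ (m : ℕ) * t i ^ (n - m : ℕ))) -
          t i * v i * P i * (w m * (u i ^ (m : ℕ) * v i ^ (n - m : ℕ))) := by
        intro m
        have e : n + 1 - (m : ℕ) = n - m + 1 := by omega
        simp only [A, Matrix.of_apply, e, one_pow]
        ring
      simp only [Matrix.mulVec, dotProduct, this, Pi.zero_apply, Finset.sum_sub_distrib,
        ← Finset.mul_sum, ← hP, ← hQ]
      ring
  refine ⟨((X : R[X]) • A.map C + B.map C).det, ?_, fun x => ?_⟩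
  · refine (degree_lt_iff_coeff_zero _ _).2 fun m hm => ?_
    have hd := natDegree_det_X_add_C_le A B
    rw [Fintype.card_fin] at hd
    rcases hm.eq_or_lt with rfl | hm
    · have := coeff_det_X_add_C_card A B
      rwa [Fintype.card_fin, hA] at this
    · exact coeff_eq_zero_of_natDegree_lt (lt_of_le_of_lt hd hm)
  · rw [← coe_evalRingHom, RingHom.map_det]
    refine congrArg Matrix.det ?_
    ext i m
    simp only [ikMatrix, A, B, u, v, P, Q, Matrix.of_apply, RingHom.mapMatrix_apply,
      Matrix.map_apply, Matrix.add_apply, Matrix.smul_apply, Fin.prod_univ_succ, Fin.cons_zero,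
      Fin.cons_succ, smul_eq_mul, coe_evalRingHom, eval_add, eval_mul, eval_X,
      eval_C]
    ring

/-- Permuting the row parameters permutes pairwise commuting transfer matrices. -/
theorem dwbcPartition_ofFn_comp_perm {R : Type*} [CommRing R] [IsDomain R] (p q : R) {n m : ℕ}
    (t : Fin m → R) (s : Fin n → R)
    (h : ∀ i j, 1 - t j - (p + q - 1) * t i + p * q * t i * t j ≠ 0) (π : Equiv.Perm (Fin m)) :
    dwbcPartition p q (List.ofFn (t ∘ π)) s = dwbcPartition p q (List.ofFn t) s := by
  have := ((π.ofFn_comp_perm t).map fun u => rowTransfer p q u n s false true).prod_eq' ?_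
  · rw [dwbcPartition, this, dwbcPartition]
  · rw [List.pairwise_map]
    refine List.pairwise_of_forall_mem_list fun a ha b hb => ?_
    obtain ⟨i, rfl⟩ := (List.mem_ofFn' _ _).1 ha
    obtain ⟨j, rfl⟩ := (List.mem_ofFn' _ _).1 hb
    exact commute_rowTransfer _ _ _ _ _ (h _ _)

/-- Determinant formula for the partition function of the six-vertex model with domain wall
boundary conditions. -/
theorem dwbcPartition_mul_eq_det {K : Type*} [Field K] (p q : K) {n : ℕ} (t s : Fin n → K)
    (ht : Function.Injective t) (h0 : ∀ i, t i ≠ 0)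
    (h : ∀ i j, 1 - t j - (p + q - 1) * t i + p * q * t i * t j ≠ 0) :
    dwbcPartition p q (List.ofFn t) s * (∏ i, (1 - p * t i)) * (Matrix.projVandermonde 1 t).det =
      (ikMatrix p q t s).det := by
  induction n with
  | zero => simp [dwbcPartition, Subsingleton.elim (fun _ : Fin 0 => false) fun _ => true]
  | succ n ih =>
    have key : ∀ (t s : Fin (n + 1) → K), Function.Injective t → (∀ i, t i ≠ 0) →
        (∀ i j, 1 - t j - (p + q - 1) * t i + p * q * t i * t j ≠ 0) → t 0 * s 0 = 1 →
        dwbcPartition p q (List.ofFn t) s * (∏ i, (1 - p * t i)) *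
          (Matrix.projVandermonde 1 t).det = (ikMatrix p q t s).det := by
      intro t s ht h0 h hts
      rw [det_ikMatrix_of_mul_eq_one p q t s hts, ← ih (Fin.tail t) (Fin.tail s)
        (ht.comp (Fin.succ_injective n)) (fun i => h0 _) (fun i j => h _ _), List.ofFn_succ,
        dwbcPartition_cons_of_mul_eq_one p q s _ _ hts, Matrix.det_projVandermonde,
        Matrix.det_projVandermonde, Fin.prod_univ_succ, Fin.prod_univ_succ, Fin.prod_Ioi_zero,
        List.map_ofFn, List.prod_ofFn, Finset.prod_mul_distrib]
      have e : (List.ofFn fun i : Fin n => t i.succ) = List.ofFn (Fin.tail t) := rfl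
      simp only [e, Fin.prod_Ioi_succ, Function.comp_apply, Pi.one_apply, one_mul, Fin.tail]
      ring
    have hpoly : ∀ x, dwbcPartition p q (List.ofFn t) (Fin.cons x (Fin.tail s) : Fin (n + 1) → K) *
        (∏ i, (1 - p * t i)) * (Matrix.projVandermonde 1 t).det =
        (ikMatrix p q t (Fin.cons x (Fin.tail s) : Fin (n + 1) → K)).det := by
      obtain ⟨P, hP, hP'⟩ := (isPolyDegLT_dwbcPartition p q (Fin.tail s) (List.ofFn t)).const_mul
        ((∏ i, (1 - p * t i)) * (Matrix.projVandermonde 1 t).det)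
      obtain ⟨Q, hQ, hQ'⟩ := isPolyDegLT_det_ikMatrix p q t (Fin.tail s)
      rw [List.length_ofFn] at hP
      have hPQ : P = Q := by
        -- Two polynomials of degree less than `n + 1` in the first column parameter are compared at
        -- the `n + 1` distinct points `(t i)⁻¹`. Swapping rows 0 and `i` reduces each point to
        -- `key`; the sign of the swap appears in both determinants.
        refine Polynomial.eq_of_degrees_lt_of_eval_index_eq (s := Finset.univ)
          (v := fun i => (t i)⁻¹) (inv_injective.comp ht).injOn (by simpa using hP)
          (by simpa using hQ) fun i _ => ?_
        rw [← hP', ← hQ']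
        let π : Equiv.Perm (Fin (n + 1)) := Equiv.swap 0 i
        have hk := key (t ∘ π) (Fin.cons (t i)⁻¹ (Fin.tail s)) (ht.comp π.injective)
          (fun j => h0 _) (fun j k => h _ _) (by simp [π, h0])
        have e1 : Matrix.projVandermonde 1 (t ∘ π) = (Matrix.projVandermonde 1 t).submatrix π id :=
          rfl
        have e2 : ikMatrix p q (t ∘ π) (Fin.cons (t i)⁻¹ (Fin.tail s)) =
          (ikMatrix p q t (Fin.cons (t i)⁻¹ (Fin.tail s))).submatrix π id := rfl
        rw [dwbcPartition_ofFn_comp_perm p q t _ h, e1, e2, Matrix.det_permute,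
          Matrix.det_permute] at hk
        simp only [Function.comp_apply] at hk
        rw [Equiv.prod_comp π fun j => 1 - p * t j] at hk
        have hs : ((Equiv.Perm.sign π : ℤ) : K) * ((Equiv.Perm.sign π : ℤ) : K) = 1 := by
          rw [← Int.cast_mul, ← Units.val_mul, Int.units_mul_self]; simp
        linear_combination ((Equiv.Perm.sign π : ℤ) : K) * hk +
          ((ikMatrix p q t (Fin.cons (t i)⁻¹ (Fin.tail s))).det -
            dwbcPartition p q (List.ofFn t) (Fin.cons (t i)⁻¹ (Fin.tail s) : Fin (n + 1) → K) *
            (∏ i, (1 - p * t i)) * (Matrix.projVandermonde 1 t).det) * hs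
      intro x
      refine Eq.trans ?_ (((hP' x).trans (by rw [hPQ])).trans (hQ' x).symm)
      ring
    have := hpoly (s 0)
    rwa [Fin.cons_self_tail] at this

/-! ### The homogeneous limit. -/

theorem map_vertexWeight {R S : Type*} [CommRing R] [CommRing S] (φ : R →+* S) (p q t s : R)
    (l r a b : Bool) :
    vertexWeight (φ p) (φ q) (φ t) (φ s) l r a b = φ (vertexWeight p q t s l r a b) := by
  cases l <;> cases r <;> cases a <;> cases b <;> simp [vertexWeight]

theorem map_rowTransfer {R S : Type*} [CommRing R] [CommRing S] (φ : R →+* S) (p q t : R) {n : ℕ}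
    (s : Fin n → R) (l r : Bool) :
    rowTransfer (φ p) (φ q) (φ t) n (φ ∘ s) l r = φ.mapMatrix (rowTransfer p q t n s l r) := by
  induction n generalizing l with
  | zero =>
    ext σ τ
    simp only [rowTransfer, Matrix.of_apply, RingHom.mapMatrix_apply, Matrix.map_apply]
    split_ifs <;> simp
  | succ n ih =>
    ext σ τ
    have h : Fin.tail (φ ∘ s) = φ ∘ Fin.tail s := rfl
    simp only [rowTransfer, Matrix.of_apply, RingHom.mapMatrix_apply, Matrix.map_apply, map_sum,
      map_mul, h, ih, ← map_vertexWeight, Function.comp_apply]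

theorem map_dwbcPartition {R S : Type*} [CommRing R] [CommRing S] (φ : R →+* S) (p q : R)
    (t : List R) {n : ℕ} (s : Fin n → R) :
    dwbcPartition (φ p) (φ q) (t.map φ) (φ ∘ s) = φ (dwbcPartition p q t s) := by
  have h : (t.map φ).map (fun u => rowTransfer (φ p) (φ q) u n (φ ∘ s) false true) =
      (t.map fun u => rowTransfer p q u n s false true).map φ.mapMatrix := by
    simp [map_rowTransfer]
  rw [dwbcPartition, h, ← map_list_prod]
  rfl

theorem map_ikMatrix {R S : Type*} [CommRing R] [CommRing S] (φ : R →+* S) (p q : R) {n : ℕ}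
    (t s : Fin n → R) : ikMatrix (φ p) (φ q) (φ ∘ t) (φ ∘ s) = φ.mapMatrix (ikMatrix p q t s) := by
  ext i m
  simp [ikMatrix]

open Polynomial in
/-- Extraction of the homogeneous limit of a determinant divided by a Vandermonde determinant. -/
theorem eval_zero_eq_det_coeff {F : Type*} [Field F] {n : ℕ} (c : Fin n → F)
    (hc : Function.Injective c) (ψ : Fin n → F[X]) (G : F[X])
    (h : G * (Matrix.projVandermonde 1 fun i => C (c i) * X).det =
      (Matrix.of fun i m => (ψ m).comp (C (c i) * X)).det) :
    G.eval 0 = (Matrix.of fun k m : Fin n => (ψ m).coeff k.rev).det := by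
  let V : Matrix (Fin n) (Fin n) F := Matrix.projVandermonde 1 c
  have hV : V.det ≠ 0 := by
    rw [Matrix.det_projVandermonde]
    refine Finset.prod_ne_zero_iff.2 fun i _ => Finset.prod_ne_zero_iff.2 fun j hj => ?_
    simp only [Pi.one_apply, one_mul]
    exact sub_ne_zero.2 fun h => (Finset.mem_Ioi.1 hj).ne (hc h)
  have hr : ∀ i m, ∃ r : F[X], (ψ m).comp (C (c i) * X) =
      ∑ k : Fin n, C (c i ^ (k.rev : ℕ) * (ψ m).coeff k.rev) * X ^ (k.rev : ℕ) + X ^ n * r := by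
    intro i m
    have : X ^ n ∣ (ψ m).comp (C (c i) * X) -
        ∑ k : Fin n, C (c i ^ (k.rev : ℕ) * (ψ m).coeff k.rev) * X ^ (k.rev : ℕ) := by
      rw [X_pow_dvd_iff]
      intro d hd
      have e := Equiv.sum_comp Fin.revPerm
        fun k : Fin n => C (c i ^ (k : ℕ) * (ψ m).coeff k) * X ^ (k : ℕ)
      simp only [Fin.revPerm_apply] at e
      rw [e, coeff_sub, comp_C_mul_X_coeff, finsetSum_coeff]
      simp only [coeff_C_mul, coeff_X_pow]
      rw [Finset.sum_eq_single ⟨d, hd⟩]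
      · simp [mul_comm]
      · intro k _ hk
        rw [if_neg fun h => hk (Fin.ext h.symm), mul_zero]
      · simp
    obtain ⟨r, hr⟩ := this
    exact ⟨r, by rw [← hr]; ring⟩
  choose r hr using hr
  -- Truncating the `ψ m` at degree `n` factors the right-hand matrix as `V * D * (Ψ + D' * r')`:
  -- the low coefficients give `Ψ`, and the remainder `X ^ n * r` gives the second term because `D *
  -- D' = X ^ n`. The Vandermonde matrix is `V * D`, so it cancels, and `D'` vanishes at 0.
  let D : Matrix (Fin n) (Fin n) F[X] := Matrix.diagonal fun k => X ^ (k.rev : ℕ)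
  let D' : Matrix (Fin n) (Fin n) F[X] := Matrix.diagonal fun k => X ^ (k + 1 : ℕ)
  let Ψ : Matrix (Fin n) (Fin n) F := Matrix.of fun k m : Fin n => (ψ m).coeff k.rev
  let r' : Matrix (Fin n) (Fin n) F[X] := C.mapMatrix V⁻¹ * Matrix.of r
  have hVr : C.mapMatrix V * r' = Matrix.of r := by
    rw [← Matrix.mul_assoc, ← map_mul, Matrix.mul_nonsing_inv _ (Ne.isUnit hV), map_one,
      Matrix.one_mul]
  have hDD : D * D' = (X ^ n : F[X]) • (1 : Matrix (Fin n) (Fin n) F[X]) := by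
    rw [Matrix.diagonal_mul_diagonal, Matrix.smul_one_eq_diagonal]
    congr 1
    funext k
    rw [← pow_add, Fin.val_rev]
    congr 1
    omega
  have hW : (Matrix.projVandermonde 1 fun i => C (c i) * X) = C.mapMatrix V * D := by
    ext1 i k
    rw [Matrix.mul_diagonal]
    simp [Matrix.projVandermonde_apply, V, mul_pow]
  have hM : (Matrix.of fun i m => (ψ m).comp (C (c i) * X)) =
      C.mapMatrix V * D * (C.mapMatrix Ψ + D' * r') := by
    rw [Matrix.mul_add, Matrix.mul_assoc _ D (D' * r'), ← Matrix.mul_assoc D, hDD,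
      Matrix.smul_mul, Matrix.one_mul, Matrix.mul_smul, hVr]
    ext1 i m
    rw [Matrix.of_apply, hr, Matrix.add_apply, Matrix.mul_apply]
    congr 1
    refine Finset.sum_congr rfl fun k _ => ?_
    rw [Matrix.mul_diagonal]
    simp only [RingHom.mapMatrix_apply, Matrix.map_apply, V, Ψ, Matrix.of_apply,
      Matrix.projVandermonde_apply, Pi.one_apply, one_pow, one_mul, map_mul]
    ring
  rw [hW, hM, Matrix.det_mul _ (C.mapMatrix Ψ + _), mul_comm] at h
  have hne : (C.mapMatrix V * D).det ≠ 0 := by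
    rw [Matrix.det_mul, Matrix.det_diagonal, ← RingHom.map_det]
    exact mul_ne_zero (by simpa using hV) (Finset.prod_ne_zero_iff.2 fun k _ => by simp)
  have hG := mul_left_cancel₀ hne h
  rw [hG, ← coe_evalRingHom, RingHom.map_det, map_add, map_mul]
  have hD' : (evalRingHom (0 : F)).mapMatrix D' = 0 := by
    ext i j
    simp [D', Matrix.diagonal_apply, apply_ite]
  have hΨ : (evalRingHom (0 : F)).mapMatrix (C.mapMatrix Ψ) = Ψ := by
    ext i j
    simp
  rw [hD', hΨ, Matrix.zero_mul, add_zero]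

open Polynomial in
/-- The homogeneous limit of the determinant formula for the partition function. -/
theorem dwbcPartition_zero_eq_det {F : Type*} [Field F] [CharZero F] (p q : F) (n : ℕ) :
    dwbcPartition p q (List.replicate n 0) (fun _ : Fin n => 0) =
      (Matrix.of fun k j : Fin n => ((1 - C (p * q) * X) ^ (n - 1 - j : ℕ) *
        (1 - C (p + q - 1) * X) ^ (j + 1 : ℕ) -
          X ^ (j + 1 : ℕ) * (1 - C (p * q) * X) ^ n).coeff (k : ℕ)).det := by
  -- Row parameters `c i * X` with distinct nonzero `c i` are admissible in the determinant formula
  -- over the fraction field, and all become 0 at `X = 0`.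
  let c : Fin n → F := fun i => (i : ℕ) + 1
  have hc : Function.Injective c := fun i j h => by simpa [c, Fin.ext_iff] using h
  have hc0 : ∀ i, c i ≠ 0 := fun i => by simp only [c]; norm_cast
  let t : Fin n → F[X] := fun i => C (c i) * X
  let ψ : Fin n → F[X] := fun j => (1 - C (p * q) * X) ^ (n - 1 - j : ℕ) *
        (1 - C (p + q - 1) * X) ^ (j + 1 : ℕ) - X ^ (j + 1 : ℕ) * (1 - C (p * q) * X) ^ n
  let φ := algebraMap F[X] (FractionRing F[X])
  have hφ : Function.Injective φ := IsFractionRing.injective _ _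
  have hM : ikMatrix (C p) (C q) t (fun _ => 0) =
      Matrix.of fun i m => (ψ m.rev).comp (C (c i) * X) := by
    ext1 i m
    have e1 : n - 1 - (n - (m + 1 : ℕ)) = m := by omega
    have e2 : n - (m + 1 : ℕ) + 1 = n - m := by omega
    simp [ikMatrix, ψ, t, e1, e2]
  have key : dwbcPartition (C p) (C q) (List.ofFn t) (fun _ : Fin n => 0) *
      (∏ i, (1 - C p * t i)) * (Matrix.projVandermonde 1 t).det =
        (ikMatrix (C p) (C q) t (fun _ => 0)).det := by
    apply hφ
    have h := dwbcPartition_mul_eq_det (φ (C p)) (φ (C q)) (φ ∘ t) (φ ∘ fun _ : Fin n => 0) ?_ ?_ ?_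
    · have e1 : List.ofFn (φ ∘ t) = (List.ofFn t).map φ := by rw [List.map_ofFn]
      have e2 : Matrix.projVandermonde 1 (φ ∘ t) = φ.mapMatrix (Matrix.projVandermonde 1 t) := by
        ext i j
        simp [Matrix.projVandermonde_apply]
      rw [e1, e2, map_dwbcPartition, map_ikMatrix, ← RingHom.map_det, ← RingHom.map_det] at h
      rw [← h, map_mul, map_mul, map_prod]
      simp
    · refine hφ.comp fun i j hij => hc ?_
      have := congrArg (fun P => coeff P 1) hij
      simpa [t] using this
    · intro i
      simp only [Function.comp_apply]
      rw [map_ne_zero_iff φ hφ]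
      simp [t, hc0]
    · intro i j h
      simp only [Function.comp_apply, ← map_mul, ← map_add, ← map_one φ, ← map_sub] at h
      -- At `X = 0` the forbidden expression takes the value 1.
      have h' := congrArg (eval 0) ((map_eq_zero_iff φ hφ).1 h)
      simp [t] at h'
  rw [hM] at key
  have h := eval_zero_eq_det_coeff c hc _ _ key
  have e := map_dwbcPartition (evalRingHom (0 : F)) (C p) (C q) (List.ofFn t) (fun _ : Fin n => 0)
  have e1 : (List.ofFn t).map (evalRingHom (0 : F)) = List.replicate n 0 := by
    rw [List.map_ofFn, ← List.ofFn_const]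
    congr 1
    funext i
    simp [t]
  have e2 : (evalRingHom (0 : F)) ∘ (fun _ : Fin n => (0 : F[X])) = fun _ => 0 := by
    funext i; simp
  rw [e1, e2] at e
  simp only [coe_evalRingHom, eval_C] at e
  rw [e]
  have e3 : eval 0 (∏ i, (1 - C p * t i)) = 1 := by
    rw [eval_prod]
    exact Finset.prod_eq_one fun i _ => by simp [t]
  rw [eval_mul, e3, mul_one] at h
  rw [h, ← Matrix.det_submatrix_equiv_self Fin.revPerm]
  congr 1
  ext k j
  simp only [Matrix.submatrix_apply, Matrix.of_apply, Fin.revPerm_apply, Fin.rev_rev, ψ]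

/-! ### Alternating sign matrices as six-vertex states. -/

theorem prod_ofFn_apply_eq_sum {R S : Type*} [CommRing R] [Fintype S] [DecidableEq S] {k : ℕ}
    (M : Fin k → Matrix S S R) (a b : S) :
    (List.ofFn M).prod a b = ∑ v : Fin (k + 1) → S,
      if v 0 = a ∧ v (Fin.last k) = b then ∏ i, M i (v i.castSucc) (v i.succ) else 0 := by
  induction k generalizing a with
  | zero =>
    rw [sum_fin_succ_pi]
    simp only [List.ofFn_zero, List.prod_nil, Matrix.one_apply]
    simp only [Fin.cons_zero, Fin.last_zero, Finset.univ_eq_empty, Finset.prod_empty,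
      Fintype.sum_unique]
    by_cases h : a = b
    · subst h
      simp
    · rw [if_neg h, Finset.sum_eq_zero]
      rintro c -
      exact if_neg fun hc => h (hc.1.symm.trans hc.2)
  | succ k ih =>
    have hr : (∑ v : Fin (k + 2) → S, if v 0 = a ∧ v (Fin.last (k + 1)) = b then
        ∏ i, M i (v i.castSucc) (v i.succ) else 0) = ∑ v : Fin (k + 1) → S,
          if v (Fin.last k) = b then
            M 0 a (v 0) * ∏ i : Fin k, M i.succ (v i.castSucc) (v i.succ) else 0 := by
      rw [sum_fin_succ_pi, Finset.sum_eq_single a]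
      · simp only [Fin.prod_univ_succ, ← Fin.succ_last, Fin.castSucc_zero, Fin.cons_zero,
          Fin.cons_succ, true_and, ← Fin.succ_castSucc]
      · intro c _ hc
        refine Finset.sum_eq_zero fun v _ => if_neg fun h => hc ?_
        simpa using h.1
      · simp
    rw [hr, List.ofFn_succ, List.prod_cons, Matrix.mul_apply]
    simp only [ih, Finset.mul_sum]
    rw [Finset.sum_comm]
    refine Finset.sum_congr rfl fun v _ => ?_
    rw [Finset.sum_eq_single (v 0)]
    · simp only [true_and, mul_ite, mul_zero]
    · intro c _ hc
      rw [if_neg fun h => hc h.1.symm, mul_zero]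
    · simp

theorem rowTransfer_eq_prod {R : Type*} [CommRing R] (p q t : R) {n : ℕ} (s : Fin n → R)
    (l r : Bool) (σ τ : Fin n → Bool) :
    rowTransfer p q t n s l r σ τ =
      (List.ofFn fun k : Fin n => (Matrix.of fun l r => vertexWeight p q t (s k) l r (σ k) (τ k) :
        Matrix Bool Bool R)).prod l r := by
  induction n generalizing l with
  | zero => simp [rowTransfer, Matrix.one_apply]
  | succ n ih =>
    rw [List.ofFn_succ, List.prod_cons, Matrix.mul_apply, rowTransfer, Matrix.of_apply]
    refine Finset.sum_congr rfl fun m _ => ?_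
    rw [ih]
    rfl

/-- Sum of the first `k` values of `b`. -/
def initSum {n : ℕ} (b : Fin n → ℤ) (k : Fin (n + 1)) : ℤ :=
  ∑ j, if j.castSucc < k then b j else 0

theorem initSum_zero {n : ℕ} (b : Fin n → ℤ) : initSum b 0 = 0 := by
  simp [initSum]

theorem initSum_last {n : ℕ} (b : Fin n → ℤ) : initSum b (Fin.last n) = ∑ j, b j := by
  simp [initSum, Fin.castSucc_lt_last]

theorem initSum_succ {n : ℕ} (b : Fin n → ℤ) (k : Fin n) :
    initSum b k.succ = initSum b k.castSucc + b k := by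
  have : b k = ∑ j, if j = k then b j else 0 := by simp
  rw [this, initSum, initSum, ← Finset.sum_add_distrib]
  refine Finset.sum_congr rfl fun j _ => ?_
  rcases lt_trichotomy j k with h | rfl | h
  · simp [h, h.ne, Fin.castSucc_lt_succ_iff, h.le]
  · simp
  · simp [h.ne', Fin.castSucc_lt_succ_iff, h.le, h.not_ge]

theorem sum_Iic_eq_initSum {n : ℕ} (b : Fin n → ℤ) (k : Fin n) :
    ∑ j ∈ Finset.Iic k, b j = initSum b k.succ := by
  rw [initSum, ← Finset.sum_filter]
  congr 1
  ext j
  simp [Fin.castSucc_lt_succ_iff]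

theorem sum_Iio_eq_initSum {n : ℕ} (b : Fin n → ℤ) (k : Fin n) :
    ∑ j ∈ Finset.Iio k, b j = initSum b k.castSucc := by
  rw [initSum, ← Finset.sum_filter]
  congr 1
  ext j
  simp

theorem initSum_eq_of_sub {n : ℕ} (b : Fin n → ℤ) (f : Fin (n + 1) → ℤ) (h0 : f 0 = 0)
    (h : ∀ k : Fin n, b k = f k.succ - f k.castSucc) (k : Fin (n + 1)) : initSum b k = f k := by
  induction k using Fin.induction with
  | zero => rw [initSum_zero, h0]
  | succ k ih => rw [initSum_succ, ih, h]; ring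

theorem isASM_iff_initSum {n : ℕ} (B : Matrix (Fin n) (Fin n) ℤ) :
    IsASM B ↔ (∀ i k, initSum (B i) k = 0 ∨ initSum (B i) k = 1) ∧
      (∀ j k, initSum (fun i => B i j) k = 0 ∨ initSum (fun i => B i j) k = 1) ∧
      (∀ i, initSum (B i) (Fin.last n) = 1) ∧
      (∀ j, initSum (fun i => B i j) (Fin.last n) = 1) := by
  constructor
  · intro h
    refine ⟨fun i k => ?_, fun j k => ?_, fun i => ?_, fun j => ?_⟩
    · cases k using Fin.cases with
      | zero => exact Or.inl (initSum_zero _)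
      | succ k =>
        have := h.row_partial i k
        rw [sum_Iic_eq_initSum] at this
        omega
    · cases k using Fin.cases with
      | zero => exact Or.inl (initSum_zero _)
      | succ k =>
        have := h.col_partial j k
        rw [sum_Iic_eq_initSum fun i => B i j] at this
        omega
    · rw [initSum_last, h.row_sum]
    · rw [initSum_last, h.col_sum]
  · rintro ⟨h1, h2, h3, h4⟩
    refine ⟨fun i j => ?_, fun i => ?_, fun j => ?_, fun i k => ?_, fun j k => ?_⟩
    · have e := initSum_succ (B i) j
      have := h1 i j.succ
      have := h1 i j.castSucc
      omega
    · rw [← initSum_last, h3]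
    · rw [← h4 j, initSum_last]
    · have := h1 i k.succ
      rw [sum_Iic_eq_initSum]
      omega
    · have := h2 j k.succ
      rw [sum_Iic_eq_initSum fun i => B i j]
      omega

/-- Splitting the row sum as its previous value plus `B i j` gives two terms. The first totals
`asmInv B`. The second totals minus the number of entries -1, since the column sum above an entry is
1 if the entry is -1 and 0 if it is 1. Thus the exponent of y counts vertices whose right and top
edges are both `true`. -/
theorem sum_mul_initSum_eq {n : ℕ} {B : Matrix (Fin n) (Fin n) ℤ} (hB : IsASM B) :
    ∑ i, ∑ j, initSum (B i) j.succ * initSum (fun i => B i j) i.castSucc =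
      asmInv B - asmNegCount B := by
  have hN : (asmNegCount B : ℤ) = ∑ l, ∑ i, if B i l = -1 then 1 else 0 := by
    rw [asmNegCount, Finset.card_filter, Fintype.sum_prod_type_right]
    push_cast
    rfl
  have hcol : ∀ l, ∑ j : Fin n, initSum (fun i => B i l) j.castSucc * B j l =
      -∑ i, (if B i l = -1 then (1 : ℤ) else 0) := by
    intro l
    have h1 : ∀ j : Fin n, 2 * (initSum (fun i => B i l) j.castSucc * B j l) =
        initSum (fun i => B i l) j.succ ^ 2 - initSum (fun i => B i l) j.castSucc ^ 2 - B j l -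
          2 * (if B j l = -1 then (1 : ℤ) else 0) := by
      intro j
      rw [initSum_succ (fun i => B i l)]
      rcases hB.entry j l with h | h | h <;> simp [h] <;> ring
    have h2 : ∑ j : Fin n, (initSum (fun i => B i l) j.succ ^ 2 -
        initSum (fun i => B i l) j.castSucc ^ 2) = 1 := by
      have := initSum_eq_of_sub (fun j : Fin n => initSum (fun i => B i l) j.succ ^ 2 -
        initSum (fun i => B i l) j.castSucc ^ 2) (fun k => initSum (fun i => B i l) k ^ 2)
        (by simp [initSum_zero]) (fun k => rfl) (Fin.last n)
      rw [initSum_last, initSum_last, hB.col_sum] at this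
      simpa using this
    have h3 : 2 * ∑ j : Fin n, initSum (fun i => B i l) j.castSucc * B j l =
        2 * -∑ i, (if B i l = -1 then (1 : ℤ) else 0) := by
      rw [Finset.mul_sum, Finset.sum_congr rfl fun j _ => h1 j, Finset.sum_sub_distrib,
        Finset.sum_sub_distrib, h2, hB.col_sum, ← Finset.mul_sum]
      ring
    linarith
  have e1 : asmInv B = ∑ j : Fin n, ∑ l : Fin n,
      initSum (B j) l.castSucc * initSum (fun i => B i l) j.castSucc := by
    rw [asmInv, Finset.sum_comm' (t' := Finset.univ) (s' := fun j => Finset.Iio j) (by simp)]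
    refine Finset.sum_congr rfl fun j _ => ?_
    have : ∀ i, ∑ k, ∑ l ∈ Finset.Ioi k, B i l * B j k
        = ∑ l, ∑ k ∈ Finset.Iio l, B i l * B j k := fun i =>
      Finset.sum_comm' (by simp)
    simp only [this]
    rw [Finset.sum_comm]
    refine Finset.sum_congr rfl fun l _ => ?_
    rw [← sum_Iio_eq_initSum, ← sum_Iio_eq_initSum (fun i => B i l), Finset.sum_mul_sum,
      Finset.sum_comm]
    exact Finset.sum_congr rfl fun _ _ => Finset.sum_congr rfl fun _ _ => mul_comm _ _
  have e2 : (asmNegCount B : ℤ) = -∑ j : Fin n, ∑ l : Fin n,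
      initSum (fun i => B i l) j.castSucc * B j l := by
    rw [Finset.sum_comm, Finset.sum_congr rfl fun l _ => hcol l, hN, Finset.sum_neg_distrib,
      neg_neg]
  rw [e1, e2, sub_neg_eq_add, ← Finset.sum_add_distrib]
  refine Finset.sum_congr rfl fun i _ => ?_
  rw [← Finset.sum_add_distrib]
  refine Finset.sum_congr rfl fun j _ => ?_
  rw [initSum_succ]
  ring

theorem vertexWeight_zero_zero {R : Type*} [CommRing R] (p q : R) (l r a b : Bool)
    (h : (r.toNat : ℤ) - l.toNat = b.toNat - a.toNat) :
    vertexWeight p q 0 0 l r a b =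
      (if (b.toNat : ℤ) - a.toNat = -1 then p * q else 1) *
        ((1 - p) * (1 - q)) ^ (r.toNat * a.toNat) := by
  cases l <;> cases r <;> cases a <;> cases b <;> simp [vertexWeight] at h ⊢

theorem vertexWeight_eq_zero {R : Type*} [CommRing R] (p q t s : R) (l r a b : Bool)
    (h : (r.toNat : ℤ) - l.toNat ≠ b.toNat - a.toNat) : vertexWeight p q t s l r a b = 0 := by
  cases l <;> cases r <;> cases a <;> cases b <;> simp [vertexWeight] at h ⊢

theorem decide_toNat_of_zero_or_one {a : ℤ} (h : a = 0 ∨ a = 1) :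
    ((decide (a = 1)).toNat : ℤ) = a := by
  rcases h with rfl | rfl <;> simp

/-- The edges of a state are the partial row and column sums of a matrix; an entry of the matrix is
the change across its vertex. -/
theorem dwbcPartition_zero_eq_asmPartition {R : Type*} [CommRing R] (p q : R) (n : ℕ) :
    dwbcPartition p q (List.replicate n 0) (fun _ : Fin n => 0) =
      asmPartition n (p * q) ((1 - p) * (1 - q)) := by
  have e1 : (List.replicate n (0 : R)).map (fun u => rowTransfer p q u n (fun _ => 0) false true) =
      List.ofFn fun _ : Fin n => rowTransfer p q 0 n (fun _ => 0) false true := by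
    rw [List.map_replicate, List.ofFn_const]
  have e2 : dwbcPartition p q (List.replicate n 0) (fun _ : Fin n => 0) =
      ∑ v : Fin (n + 1) → Fin n → Bool, ∑ h : Fin n → Fin (n + 1) → Bool,
        if (v 0 = (fun _ => false) ∧ v (Fin.last n) = fun _ => true) ∧
          ∀ i, h i 0 = false ∧ h i (Fin.last n) = true then
          ∏ i, ∏ j, vertexWeight p q 0 0 (h i j.castSucc) (h i j.succ)
            (v i.castSucc j) (v i.succ j) else 0 := by
    rw [dwbcPartition, e1, prod_ofFn_apply_eq_sum]
    refine Finset.sum_congr rfl fun v _ => ?_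
    split_ifs with hv
    · simp only [rowTransfer_eq_prod, prod_ofFn_apply_eq_sum, Matrix.of_apply, hv, true_and]
      rw [Finset.prod_univ_sum, Fintype.piFinset_univ]
      refine Finset.sum_congr rfl fun h _ => ?_
      split_ifs with hh
      · exact Finset.prod_congr rfl fun i _ => if_pos (hh i)
      · obtain ⟨i, hi⟩ := not_forall.1 hh
        exact Finset.prod_eq_zero (Finset.mem_univ i) (if_neg hi)
    · simp [hv]
  rw [e2, ← Fintype.sum_prod_type', asmPartition]
  symm
  refine Finset.sum_of_injOn (fun B => (fun k j => decide (initSum (fun i => B i j) k = 1),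
    fun i k => decide (initSum (B i) k = 1))) ?_ ?_ ?_ ?_
  · intro B hB B' hB' h
    have hB := (isASM_iff_initSum B).1 (by simpa using hB)
    have hB' := (isASM_iff_initSum B').1 (by simpa using hB')
    ext i j
    have h' : ∀ k, initSum (B i) k = initSum (B' i) k := fun k => by
      have := congrArg (fun b : Bool => (b.toNat : ℤ)) (congrFun (congrFun (Prod.ext_iff.1 h).2 i) k)
      simpa only [decide_toNat_of_zero_or_one (hB.1 i k), decide_toNat_of_zero_or_one (hB'.1 i k)]
        using this
    have h1 := initSum_succ (B i) j
    have h2 := initSum_succ (B' i) j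
    rw [h', h'] at h1
    omega
  · intro B _
    simp
  · rintro ⟨v, h⟩ - hvh
    by_contra hne
    apply hvh
    dsimp only at hne
    obtain ⟨⟨⟨hv0, hv1⟩, hh⟩, hne⟩ := (ite_ne_right_iff.1 hne)
    -- A state of nonzero weight obeys the ice rule, so horizontal and vertical edges define the
    -- same matrix.
    have hice : ∀ i j, ((h i j.succ).toNat : ℤ) - (h i j.castSucc).toNat =
        (v i.succ j).toNat - (v i.castSucc j).toNat := by
      intro i j
      by_contra hc
      exact hne (Finset.prod_eq_zero (Finset.mem_univ i)
        (Finset.prod_eq_zero (Finset.mem_univ j) (vertexWeight_eq_zero _ _ _ _ _ _ _ _ hc)))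
    let B : Matrix (Fin n) (Fin n) ℤ := fun i j =>
      ((h i j.succ).toNat : ℤ) - (h i j.castSucc).toNat
    have hr : ∀ i k, initSum (B i) k = (h i k).toNat := fun i k =>
      initSum_eq_of_sub (B i) (fun k => ((h i k).toNat : ℤ)) (by simp [hh]) (fun _ => rfl) k
    have hc : ∀ j k, initSum (fun i => B i j) k = (v k j).toNat := fun j k =>
      initSum_eq_of_sub (fun i => B i j) (fun k => ((v k j).toNat : ℤ)) (by simp [hv0])
        (fun i => hice i j) k
    have hb : ∀ b : Bool, ((b.toNat : ℤ) = 0 ∨ (b.toNat : ℤ) = 1) ∧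
      decide ((b.toNat : ℤ) = 1) = b := by decide
    refine ⟨B, ?_, ?_⟩
    · simp only [Set.Finite.coe_toFinset, Set.mem_ofPred_eq, isASM_iff_initSum, hr, hc]
      exact ⟨fun i k => (hb _).1, fun j k => (hb _).1, fun i => by simp [hh],
        fun j => by simp [hv1]⟩
    · simp only [hr, hc, (hb _).2]
  · intro B hB
    have hB : IsASM B := by simpa using hB
    obtain ⟨h1, h2, h3, h4⟩ := (isASM_iff_initSum B).1 hB
    rw [if_pos]
    · have hw : ∀ i j : Fin n, vertexWeight p q 0 0 (decide (initSum (B i) j.castSucc = 1))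
          (decide (initSum (B i) j.succ = 1)) (decide (initSum (fun i => B i j) i.castSucc = 1))
          (decide (initSum (fun i => B i j) i.succ = 1)) =
          (if B i j = -1 then p * q else 1) * ((1 - p) * (1 - q)) ^
            ((decide (initSum (B i) j.succ = 1)).toNat *
              (decide (initSum (fun i => B i j) i.castSucc = 1)).toNat) := by
        intro i j
        have e := initSum_succ (B i) j
        have e' := initSum_succ (fun i => B i j) i
        rw [vertexWeight_zero_zero]
        · rw [decide_toNat_of_zero_or_one (h2 j _), decide_toNat_of_zero_or_one (h2 j _)]
          simp only [e', add_sub_cancel_left]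
        · rw [decide_toNat_of_zero_or_one (h2 j _), decide_toNat_of_zero_or_one (h2 j _),
            decide_toNat_of_zero_or_one (h1 i _), decide_toNat_of_zero_or_one (h1 i _)]
          omega
      have hy : (asmInv B - asmNegCount B).toNat = ∑ i : Fin n, ∑ j : Fin n,
          ((decide (initSum (B i) j.succ = 1)).toNat *
              (decide (initSum (fun i => B i j) i.castSucc = 1)).toNat) := by
        rw [← sum_mul_initSum_eq hB, ← Int.toNat_natCast (Finset.sum _ _)]
        congr 1
        push_cast
        refine Finset.sum_congr rfl fun i _ => Finset.sum_congr rfl fun j _ => ?_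
        rw [decide_toNat_of_zero_or_one (h2 j _), decide_toNat_of_zero_or_one (h1 i _)]
      simp only [hw, Finset.prod_mul_distrib]
      rw [hy]
      congr 1
      · rw [← Fintype.prod_prod_type' fun i j => if B i j = -1 then p * q else 1, asmNegCount,
          Finset.prod_ite, Finset.prod_const, Finset.prod_const_one, mul_one]
      · simp only [Finset.prod_pow_eq_pow_sum]
    · refine ⟨⟨?_, ?_⟩, fun i => ⟨?_, ?_⟩⟩
      · funext j; simp [initSum_zero]
      · funext j; simp [h4]
      · simp [initSum_zero]
      · simp [h3]

/-! ### Determinants summed over interlacing sequences. -/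

/-- The value of `f` at the successor of `i`, and `0` if `i` is the last index. -/
def nextVal {r : ℕ} (f : Fin r → ℕ) (i : Fin r) : ℕ :=
  if h : (i : ℕ) + 1 < r then f ⟨i + 1, h⟩ else 0

theorem nextVal_castSucc {r : ℕ} (f : Fin (r + 1) → ℕ) (i : Fin r) :
    nextVal f i.castSucc = f i.succ := by
  rw [nextVal, dif_pos (by simp)]
  rfl

theorem nextVal_last {r : ℕ} (f : Fin (r + 1) → ℕ) : nextVal f (Fin.last r) = 0 := by
  rw [nextVal, dif_neg (by simp)]

theorem nextVal_le_of_strictAnti {r : ℕ} {f : Fin r → ℕ} (hf : StrictAnti f) (i : Fin r) :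
    nextVal f i ≤ f i := by
  rw [nextVal]
  split_ifs with h
  · exact (hf (Fin.lt_def.2 (by simp))).le
  · exact Nat.zero_le _

theorem strictAnti_of_nextVal_lt {r : ℕ} {f g : Fin r → ℕ} (h1 : ∀ i, nextVal f i < g i)
    (h2 : ∀ i, g i ≤ f i) : StrictAnti g := by
  cases r with
  | zero => exact fun i => i.elim0
  | succ r =>
    refine Fin.strictAnti_iff_succ_lt.2 fun i => ?_
    have := h1 i.castSucc
    rw [nextVal_castSucc] at this
    exact (h2 _).trans_lt this

theorem det_sub_next {R : Type*} [CommRing R] {r : ℕ} (A : Matrix (Fin r) (Fin r) R) :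
    (Matrix.of fun i b => A i b - if h : (i : ℕ) + 1 < r then A ⟨i + 1, h⟩ b else 0).det =
      A.det := by
  let U : Matrix (Fin r) (Fin r) R := Matrix.of fun i j =>
    if j = i then 1 else if (j : ℕ) = i + 1 then -1 else 0
  have hU : U.det = 1 := by
    rw [Matrix.det_of_isUpperTriangular]
    · simp [U]
    · intro i j hij
      have : (j : ℕ) < i := hij
      simp only [U, Matrix.of_apply]
      rw [if_neg (by rintro rfl; omega), if_neg (by omega)]
  have : (Matrix.of fun i b => A i b - if h : (i : ℕ) + 1 < r then A ⟨i + 1, h⟩ b else 0) =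
      U * A := by
    ext i b
    have e : ∀ j, U i j * A j b = (if j = i then A j b else 0) -
        (if (j : ℕ) = i + 1 then A j b else 0) := by
      intro j
      by_cases h1 : j = i
      · subst h1; simp [U]
      · by_cases h2 : (j : ℕ) = i + 1 <;> simp [U, h1, h2]
    simp only [Matrix.mul_apply, Matrix.of_apply, e, Finset.sum_sub_distrib, Finset.sum_ite_eq',
      Finset.mem_univ, if_true]
    congr 1
    split_ifs with h
    · rw [Finset.sum_eq_single ⟨i + 1, h⟩]
      · simp
      · intro j _ hj
        exact if_neg fun h' => hj (Fin.ext h')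
      · simp
    · exact (Finset.sum_eq_zero fun j _ => if_neg (by omega)).symm
  rw [this, Matrix.det_mul, hU, one_mul]

theorem det_sum_rows {R : Type*} [CommRing R] {r : ℕ} (S : Fin r → Finset ℕ)
    (g : Fin r → ℕ → R) :
    (Matrix.of fun i b => ∑ u ∈ S i, g b u).det =
      ∑ J ∈ Fintype.piFinset S, (Matrix.of fun i b => g b (J i)).det := by
  have := (Matrix.detRowAlternating (n := Fin r) (R := R)).toMultilinearMap.map_sum_finset
    (fun _ u b => g b u) S
  simp only [AlternatingMap.coe_multilinearMap] at this
  refine Eq.trans (congrArg Matrix.det ?_) this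
  ext i b
  simp [Finset.sum_apply]

theorem sum_Ioc_zero_sub {R : Type*} [CommRing R] (g : ℕ → R) {a b : ℕ} (h : a ≤ b) :
    ∑ u ∈ Finset.Ioc 0 b, g u - ∑ u ∈ Finset.Ioc 0 a, g u = ∑ u ∈ Finset.Ioc a b, g u := by
  rw [← Finset.sum_Ioc_consecutive g (Nat.zero_le a) h, add_sub_cancel_left]

/-- Subtracting from each row the next one turns initial sums into sums over the consecutive
intervals between the `I i`; multilinearity in the rows then gives a sum over interlacing sequences
`J`. -/
theorem det_sum_Ioc {R : Type*} [CommRing R] {r : ℕ} {I : Fin r → ℕ} (hI : StrictAnti I)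
    (g : Fin r → ℕ → R) :
    (Matrix.of fun i b => ∑ u ∈ Finset.Ioc 0 (I i), g b u).det =
      ∑ J ∈ Fintype.piFinset fun i => Finset.Ioc (nextVal I i) (I i),
        (Matrix.of fun i b => g b (J i)).det := by
  rw [← det_sum_rows, ← det_sub_next]
  congr 1
  ext i b
  simp only [Matrix.of_apply]
  rw [← sum_Ioc_zero_sub _ (nextVal_le_of_strictAnti hI i)]
  congr 1
  rw [nextVal]
  split_ifs <;> simp

/-- The same row differences reduce the final column of ones to a single 1 in the last row;
expanding along it loses one row and one column, so `J` has one term fewer than `I`. -/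
theorem det_sum_Ioc_snoc {R : Type*} [CommRing R] {r : ℕ} {I : Fin (r + 1) → ℕ}
    (hI : StrictAnti I) (g : Fin r → ℕ → R) :
    (Matrix.of fun i b => (Fin.snoc (fun b => ∑ u ∈ Finset.Ioc 0 (I i), g b u) 1 :
      Fin (r + 1) → R) b).det =
      ∑ J ∈ Fintype.piFinset fun i : Fin r => Finset.Ioc (I i.succ) (I i.castSucc),
        (Matrix.of fun i b => g b (J i)).det := by
  rw [← det_sum_rows, ← det_sub_next, Matrix.det_succ_column _ (Fin.last r),
    Fin.sum_univ_castSucc, Finset.sum_eq_zero, zero_add]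
  · have h : (-1 : R) ^ ((Fin.last r : ℕ) + (Fin.last r : ℕ)) = 1 := by
      rw [← two_mul, pow_mul]; simp
    rw [h]
    simp only [Matrix.of_apply, Fin.snoc_last, Fin.val_last, lt_self_iff_false, dif_neg,
      not_false_eq_true, sub_zero, one_mul]
    congr 1
    ext i b
    have hlt : (i : ℕ) + 1 < r + 1 := by omega
    have hi : (⟨i + 1, hlt⟩ : Fin (r + 1)) = i.succ := rfl
    simp only [Matrix.submatrix_apply, Fin.succAbove_last, Matrix.of_apply, Fin.snoc_castSucc,
      Fin.val_castSucc, dif_pos hlt, hi]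
    exact sum_Ioc_zero_sub _ (hI Fin.castSucc_lt_succ).le
  · intro i _
    have hlt : (i : ℕ) + 1 < r + 1 := by omega
    simp

/-! ### Shifted arrays cut into diagonals. -/

/-- Weight of a part `u` in position `k` of its row. -/
def partWeight {R : Type*} (x y : R) (k u : ℕ) : R := if u ≤ k then x else y

/-- Weight of a list of parts in positions `k`, `k + 1`, ... of a row. -/
def rowWeight {R : Type*} [CommRing R] (x y : R) : ℕ → List ℕ → R
  | _, [] => 1
  | k, a :: l => partWeight x y k a * rowWeight x y (k + 1) l

/-- Weighted count of the weakly decreasing sequences of `m` positive integers at most `v` in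
positions `k`, ..., `k + m - 1` of a row. -/
def pathWeight {R : Type*} [CommRing R] (x y : R) : ℕ → ℕ → ℕ → R
  | 0, _, _ => 1
  | m + 1, k, v => ∑ u ∈ Finset.Ioc 0 v, partWeight x y k u * pathWeight x y m (k + 1) u

/-- The rows `E` continue the column `I` to the right, in the way the rows of a descending plane
partition continue its diagonal. -/
def IsContinuation {r : ℕ} (I : Fin r → ℕ) (E : Fin r → List ℕ) : Prop :=
  ∀ i k, k < (E i).length → (E i).getD k 0 ≤ (I i :: E i).getD k 0 ∧
    nextVal (fun j => (I j :: E j).getD k 0) i < (E i).getD k 0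

theorem IsContinuation.le {r : ℕ} {I : Fin r → ℕ} {E : Fin r → List ℕ} (h : IsContinuation I E)
    (i : Fin r) (k : ℕ) (hk : k < (E i).length) : (E i).getD k 0 ≤ I i := by
  induction k with
  | zero => simpa using (h i 0 hk).1
  | succ k ih =>
    have := (h i (k + 1) hk).1
    rw [List.getD_cons_succ] at this
    exact this.trans (ih (by omega))

theorem finite_lists_le (m N : ℕ) : {l : List ℕ | l.length = m ∧ ∀ a ∈ l, a ≤ N}.Finite := by
  have : Finite (Set.Iic N) := Set.finite_Iic N
  refine ((List.finite_length_eq (Set.Iic N) m).image (List.map Subtype.val)).subset ?_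
  rintro l ⟨hl, hm⟩
  exact ⟨l.attach.map fun a => ⟨a.1, hm a.1 a.2⟩, by simpa using hl, by simp⟩

theorem finite_continuations {r : ℕ} (I l : Fin r → ℕ) :
    {E : Fin r → List ℕ | IsContinuation I E ∧ ∀ i, (E i).length = l i}.Finite := by
  refine (Set.Finite.pi' fun i => finite_lists_le (l i) (I i)).subset ?_
  rintro E ⟨hE, hl⟩ i
  refine ⟨hl i, fun a ha => ?_⟩
  obtain ⟨k, hk, rfl⟩ := List.getElem_of_mem ha
  have := hE.le i k hk
  rwa [List.getD_eq_getElem _ _ hk] at this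

/-- The continuations of `I` with row lengths `l`. -/
noncomputable def continuations {r : ℕ} (I l : Fin r → ℕ) : Finset (Fin r → List ℕ) :=
  (finite_continuations I l).toFinset

theorem mem_continuations {r : ℕ} {I l : Fin r → ℕ} {E : Fin r → List ℕ} :
    E ∈ continuations I l ↔ IsContinuation I E ∧ ∀ i, (E i).length = l i := by
  simp [continuations]

theorem isContinuation_cons {r : ℕ} (I J : Fin r → ℕ) (E : Fin r → List ℕ) :
    (IsContinuation I fun i => J i :: E i) ↔
      (∀ i, J i ∈ Finset.Ioc (nextVal I i) (I i)) ∧ IsContinuation J E := by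
  constructor
  · intro h
    refine ⟨fun i => ?_, fun i k hk => ?_⟩
    · have := h i 0 (by simp)
      simp only [List.getD_cons_zero] at this
      exact Finset.mem_Ioc.2 ⟨this.2, this.1⟩
    · have := h i (k + 1) (by simpa using hk)
      simpa only [List.getD_cons_succ] using this
  · rintro ⟨h1, h2⟩ i k hk
    cases k with
    | zero =>
      simp only [List.getD_cons_zero]
      exact (Finset.mem_Ioc.1 (h1 i)).symm
    | succ k =>
      simp only [List.getD_cons_succ]
      exact h2 i k (by simpa using hk)

theorem isContinuation_snoc {r : ℕ} (I : Fin (r + 1) → ℕ) (J : Fin r → ℕ) (E : Fin r → List ℕ) :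
    IsContinuation I (Fin.snoc (fun i => J i :: E i) [] : Fin (r + 1) → List ℕ) ↔
      (∀ i : Fin r, J i ∈ Finset.Ioc (I i.succ) (I i.castSucc)) ∧ IsContinuation J E := by
  have hn : ∀ (i : Fin r) k,
      ((Fin.snoc (fun i => J i :: E i) [] : Fin (r + 1) → List ℕ) i.succ).getD k 0 =
        nextVal (fun j => (J j :: E j).getD k 0) i := by
    intro i k
    cases r with
    | zero => exact i.elim0
    | succ r =>
      cases i using Fin.lastCases with
      | last => rw [nextVal_last, Fin.succ_last, Fin.snoc_last, List.getD_nil]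
      | cast i => rw [nextVal_castSucc, Fin.succ_castSucc, Fin.snoc_castSucc]
  constructor
  · intro h
    refine ⟨fun i => ?_, fun i k hk => ?_⟩
    · have := h i.castSucc 0 (by simp)
      simp only [List.getD_cons_zero, nextVal_castSucc, Fin.snoc_castSucc] at this
      exact Finset.mem_Ioc.2 ⟨this.2, this.1⟩
    · have := h i.castSucc (k + 1) (by simpa using hk)
      simpa only [List.getD_cons_succ, nextVal_castSucc, Fin.snoc_castSucc, hn] using this
  · rintro ⟨h1, h2⟩ i k hk
    cases i using Fin.lastCases with
    | last => simp at hk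
    | cast i =>
      cases k with
      | zero =>
        simp only [List.getD_cons_zero, nextVal_castSucc, Fin.snoc_castSucc]
        exact (Finset.mem_Ioc.1 (h1 i)).symm
      | succ k =>
        simp only [List.getD_cons_succ, nextVal_castSucc, Fin.snoc_castSucc, hn]
        exact h2 i k (by simpa using hk)

theorem sum_continuations_succ {M : Type*} [AddCommMonoid M] {r : ℕ} (I l : Fin r → ℕ)
    (f : (Fin r → List ℕ) → M) :
    ∑ E ∈ continuations I fun i => l i + 1, f E =
      ∑ J ∈ Fintype.piFinset fun i => Finset.Ioc (nextVal I i) (I i),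
        ∑ E ∈ continuations J l, f fun i => J i :: E i := by
  rw [Finset.sum_sigma']
  symm
  refine Finset.sum_bij' (fun JE _ i => JE.1 i :: JE.2 i)
    (fun E _ => ⟨fun i => (E i).headD 0, fun i => (E i).tail⟩) ?_ ?_ ?_ ?_ ?_
  · rintro ⟨J, E⟩ h
    simp only [Finset.mem_sigma, Fintype.mem_piFinset, mem_continuations] at h
    exact mem_continuations.2 ⟨(isContinuation_cons _ _ _).2 ⟨h.1, h.2.1⟩, by simp [h.2.2]⟩
  · intro E h
    obtain ⟨h, hl⟩ := mem_continuations.1 h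
    have hE : E = fun i => (E i).headD 0 :: (E i).tail := by
      funext i
      have := hl i
      cases hEi : E i with
      | nil => simp [hEi] at this
      | cons a t => simp
    rw [hE, isContinuation_cons] at h
    simp only [Finset.mem_sigma, Fintype.mem_piFinset, mem_continuations]
    exact ⟨h.1, h.2, fun i => by simp [hl]⟩
  · rintro ⟨J, E⟩ h
    simp
  · intro E h
    obtain ⟨h, hl⟩ := mem_continuations.1 h
    funext i
    have := hl i
    cases hEi : E i with
    | nil => simp [hEi] at this
    | cons a t => simp [hEi]
  · intro _ _
    rfl

theorem sum_continuations_snoc {M : Type*} [AddCommMonoid M] {r : ℕ} (I : Fin (r + 1) → ℕ)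
    (l : Fin r → ℕ) (f : (Fin (r + 1) → List ℕ) → M) :
    ∑ E ∈ continuations I (Fin.snoc (fun i => l i + 1) 0 : Fin (r + 1) → ℕ), f E =
      ∑ J ∈ Fintype.piFinset fun i : Fin r => Finset.Ioc (I i.succ) (I i.castSucc),
        ∑ E ∈ continuations J l,
          f (Fin.snoc (fun i => J i :: E i) [] : Fin (r + 1) → List ℕ) := by
  rw [Finset.sum_sigma']
  symm
  have hE' : ∀ E ∈ continuations I (Fin.snoc (fun i => l i + 1) 0 : Fin (r + 1) → ℕ),
      E = (Fin.snoc (fun i : Fin r => (E i.castSucc).headD 0 :: (E i.castSucc).tail) [] :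
        Fin (r + 1) → List ℕ) := by
    intro E h
    obtain ⟨h, hl⟩ := mem_continuations.1 h
    funext i
    have := hl i
    cases i using Fin.lastCases with
    | last => simpa using this
    | cast i =>
      cases hEi : E i.castSucc with
      | nil => simp [hEi] at this
      | cons a t => simp [hEi]
  refine Finset.sum_bij' (fun JE _ => (Fin.snoc (fun i => JE.1 i :: JE.2 i) [] :
      Fin (r + 1) → List ℕ))
    (fun E _ => ⟨fun i => (E i.castSucc).headD 0, fun i => (E i.castSucc).tail⟩) ?_ ?_ ?_ ?_ ?_
  · rintro ⟨J, E⟩ h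
    simp only [Finset.mem_sigma, Fintype.mem_piFinset, mem_continuations] at h
    refine mem_continuations.2 ⟨(isContinuation_snoc _ _ _).2 ⟨h.1, h.2.1⟩, fun i => ?_⟩
    cases i using Fin.lastCases with
    | last => simp
    | cast i => simp [h.2.2]
  · intro E h
    have hE := hE' E h
    obtain ⟨h, hl⟩ := mem_continuations.1 h
    rw [hE, isContinuation_snoc] at h
    simp only [Finset.mem_sigma, Fintype.mem_piFinset, mem_continuations]
    exact ⟨h.1, h.2, fun i => by simp [hl]⟩
  · rintro ⟨J, E⟩ h
    simp
  · intro E h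
    exact (hE' E h).symm
  · intro _ _
    rfl

/-- A Lindström–Gessel–Viennot formula by induction on row lengths. The next diagonal `J` interlaces
with `I`, its weight is a row factor, and summation over `J` is supplied by `det_sum_Ioc` or
`det_sum_Ioc_snoc`. -/
theorem sum_continuations_eq_det {R : Type*} [CommRing R] (x y : R) (L : ℕ) {r : ℕ}
    {I l : Fin r → ℕ} (k : ℕ) (hI : StrictAnti I) (hl : StrictAnti l) (hL : ∀ i, l i < L) :
    ∑ E ∈ continuations I l, ∏ i, rowWeight x y k (E i) =
      (Matrix.of fun c b => pathWeight x y (l b) k (I c)).det := by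
  induction L generalizing r I l k with
  | zero =>
    cases r with
    | zero =>
      have : continuations I l = {fun i => i.elim0} := by
        ext E
        simp only [mem_continuations, Finset.mem_singleton]
        exact ⟨fun _ => Subsingleton.elim _ _, fun _ => ⟨fun i => i.elim0, fun i => i.elim0⟩⟩
      simp [this]
    | succ r => exact absurd (hL 0) (Nat.not_lt_zero _)
  | succ L ih =>
    by_cases h0 : ∀ i, l i ≠ 0
    · obtain ⟨m, rfl⟩ : ∃ m : Fin r → ℕ, l = fun i => m i + 1 :=
        ⟨fun i => l i - 1, funext fun i => by have := h0 i; simp only; omega⟩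
      have hm : StrictAnti m := fun i j hij => by have := hl hij; simpa using this
      simp only [pathWeight]
      rw [sum_continuations_succ, det_sum_Ioc hI]
      refine Finset.sum_congr rfl fun J hJ => ?_
      have hJ' := fun i => Finset.mem_Ioc.1 (Fintype.mem_piFinset.1 hJ i)
      refine Eq.trans ?_ (Matrix.det_mul_column (fun c => partWeight x y k (J c))
        (Matrix.of fun c b => pathWeight x y (m b) (k + 1) (J c))).symm
      rw [← ih (k + 1) (strictAnti_of_nextVal_lt (fun i => (hJ' i).1) fun i => (hJ' i).2) hm
          fun i => by have := hL i; simp only at this; omega, Finset.mul_sum]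
      refine Finset.sum_congr rfl fun E _ => ?_
      simp only [rowWeight, Finset.prod_mul_distrib]
    -- By strict decrease only the last row can be empty. It contributes the factor 1 and a
    -- determinant column of ones.
    · push Not at h0
      obtain ⟨i₀, hi₀⟩ := h0
      cases r with
      | zero => exact i₀.elim0
      | succ r =>
        have hlast : l (Fin.last r) = 0 := by
          have := hl.antitone (Fin.le_last i₀)
          omega
        have hpos : ∀ i : Fin r, 0 < l i.castSucc := fun i => by
          have := hl (Fin.castSucc_lt_last i)
          omega
        obtain ⟨m, rfl⟩ : ∃ m : Fin r → ℕ, l = (Fin.snoc (fun i => m i + 1) 0 :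
            Fin (r + 1) → ℕ) := by
          refine ⟨fun i => l i.castSucc - 1, funext fun i => ?_⟩
          cases i using Fin.lastCases with
          | last => simpa using hlast
          | cast i => have := hpos i; simp; omega
        have hm : StrictAnti m := fun i j hij => by
          have := hl (Fin.castSucc_lt_castSucc_iff.2 hij)
          simpa using this
        have hM : (Matrix.of fun c b => pathWeight x y
            ((Fin.snoc (fun i => m i + 1) 0 : Fin (r + 1) → ℕ) b) k (I c)) =
            Matrix.of fun c b => (Fin.snoc (fun b => ∑ u ∈ Finset.Ioc 0 (I c),
              partWeight x y k u * pathWeight x y (m b) (k + 1) u) 1 : Fin (r + 1) → R) b := by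
          ext c b
          cases b using Fin.lastCases with
          | last => simp [pathWeight]
          | cast b => simp [pathWeight]
        rw [hM, sum_continuations_snoc, det_sum_Ioc_snoc hI fun b u =>
          partWeight x y k u * pathWeight x y (m b) (k + 1) u]
        refine Finset.sum_congr rfl fun J hJ => ?_
        have hJ' := fun i => Finset.mem_Ioc.1 (Fintype.mem_piFinset.1 hJ i)
        have hJa : StrictAnti J := by
          cases r with
          | zero => exact fun i => i.elim0
          | succ r =>
            refine Fin.strictAnti_iff_succ_lt.2 fun i => ?_
            have h1 := (hJ' i.castSucc).1
            have h2 := (hJ' i.succ).2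
            rw [← Fin.succ_castSucc] at h2
            exact h2.trans_lt h1
        refine Eq.trans ?_ (Matrix.det_mul_column (fun c => partWeight x y k (J c))
          (Matrix.of fun c b => pathWeight x y (m b) (k + 1) (J c))).symm
        rw [← ih (k + 1) hJa hm fun i => by have := hL i.castSucc; simp at this; omega,
          Finset.mul_sum]
        refine Finset.sum_congr rfl fun E _ => ?_
        rw [Fin.prod_univ_castSucc]
        simp only [rowWeight, Finset.prod_mul_distrib, Fin.snoc_castSucc, Fin.snoc_last, mul_one]

/-! ### Descending plane partitions as principal minors. -/

theorem dppRowLen_ofFn {r : ℕ} (f : Fin r → List ℕ) {i : ℕ} (h : i < r) :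
    dppRowLen (List.ofFn f) i = (f ⟨i, h⟩).length := by
  simp [dppRowLen, h]

theorem dppPart_ofFn {r : ℕ} (f : Fin r → List ℕ) {i : ℕ} (h : i < r) (k : ℕ) :
    dppPart (List.ofFn f) i k = (f ⟨i, h⟩).getD k 0 := by
  simp [dppPart, h]

theorem rowWeight_eq_prod {R : Type*} [CommRing R] (x y : R) (k : ℕ) (l : List ℕ) :
    rowWeight x y k l = ∏ j ∈ Finset.range l.length, partWeight x y (k + j) (l.getD j 0) := by
  induction l generalizing k with
  | nil => simp [rowWeight]
  | cons a l ih =>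
    rw [rowWeight, ih, List.length_cons, Finset.prod_range_succ', mul_comm]
    simp only [List.getD_cons_succ, List.getD_cons_zero, add_zero]
    congr 1
    exact Finset.prod_congr rfl fun j _ => by rw [add_right_comm, add_assoc]

theorem pow_specialCount_mul_pow_otherCount {R : Type*} [CommRing R] (x y : R) {r : ℕ}
    (f : Fin r → List ℕ) :
    x ^ specialCount (List.ofFn f) * y ^ otherCount (List.ofFn f) =
      ∏ i, rowWeight x y 0 (f i) := by
  rw [specialCount, otherCount, ← Finset.prod_pow_eq_pow_sum, ← Finset.prod_pow_eq_pow_sum,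
    ← Finset.prod_mul_distrib, List.length_ofFn, Finset.prod_range]
  refine Finset.prod_congr rfl fun i _ => ?_
  simp only [dppRowLen_ofFn f i.2, dppPart_ofFn f i.2, rowWeight_eq_prod, partWeight, zero_add,
    Finset.prod_ite, Finset.prod_const]

/-- With first parts written `α i + 1`, the inequalities between first parts and row lengths say
exactly that the lengths interlace with `α`. They imply the shape condition, and row monotonicity
reduces the bound on the parts to the first ones. -/
theorem isDPP_and_hasOrder_iff {r n : ℕ} (α : Fin r → ℕ) (E : Fin r → List ℕ) :
    (IsDPP (List.ofFn fun i => (α i + 1) :: E i) ∧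
        HasOrder (List.ofFn fun i => (α i + 1) :: E i) n) ↔
      (∀ i, (E i).length + 1 ∈ Finset.Ioc (nextVal α i) (α i)) ∧
        IsContinuation (fun i => α i + 1) E ∧ ∀ i, α i < n := by
  have hlen := fun {i : ℕ} (h : i < r) => dppRowLen_ofFn (fun i => (α i + 1) :: E i) h
  have hpart := fun {i : ℕ} (h : i < r) => dppPart_ofFn (fun i => (α i + 1) :: E i) h
  simp only [List.length_cons] at hlen
  have hL : (List.ofFn fun i => (α i + 1) :: E i).length = r := List.length_ofFn
  set D := List.ofFn fun i => (α i + 1) :: E i with hD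
  constructor
  · rintro ⟨h, ho⟩
    refine ⟨fun i => Finset.mem_Ioc.2 ⟨?_, ?_⟩, fun i k hk => ⟨?_, ?_⟩, fun i => ?_⟩
    · rw [nextVal]
      split_ifs with hi
      · have := h.first_le_len i (by omega)
        rw [hpart hi, hlen i.2, List.getD_cons_zero] at this
        simp only [Fin.eta] at this
        omega
      · omega
    · have := h.len_lt_first i (by omega)
      rw [hpart i.2, hlen i.2, List.getD_cons_zero] at this
      simp only [Fin.eta] at this
      omega
    · have := h.row_anti i (by omega) k (by rw [hlen i.2]; simpa using hk)
      rwa [hpart i.2, hpart i.2, List.getD_cons_succ] at this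
    · have hpos := h.part_pos i (by omega) (k + 1) (by rw [hlen i.2]; simpa using hk)
      rw [hpart i.2, List.getD_cons_succ] at hpos
      rw [nextVal]
      split_ifs with hi
      -- Where the row below has ended, `getD` returns 0 and the column inequality becomes
      -- positivity of the part.
      · by_cases hk' : k < dppRowLen D (i + 1)
        · have := h.col_anti i (by omega) k hk'
          rwa [hpart hi, hpart i.2, List.getD_cons_succ] at this
        · rw [hlen hi] at hk'
          rw [List.getD_eq_default _ _ (by simpa using hk')]
          exact hpos
      · exact hpos
    · have := ho i (by omega) 0 (by rw [hlen i.2]; omega)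
      rw [hpart i.2, List.getD_cons_zero] at this
      exact this
  · rintro ⟨h1, h2, h3⟩
    have hle : ∀ (i : ℕ) (hi : i < r) k, k < dppRowLen D i → dppPart D i k ≤ α ⟨i, hi⟩ + 1 := by
      intro i hi k hk
      rw [hlen hi] at hk
      rw [hpart hi]
      cases k with
      | zero => simp
      | succ k => exact h2.le ⟨i, hi⟩ k (by omega)
    have hnext : ∀ (i : ℕ) (hi : i + 1 < r) (f : Fin r → ℕ),
        nextVal f ⟨i, by omega⟩ = f ⟨i + 1, hi⟩ := fun i hi f => by
      rw [nextVal, dif_pos hi]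
    refine ⟨⟨?_, ?_, ?_, ?_, ?_, ?_, ?_⟩, ?_⟩
    · intro i hi
      rw [hL] at hi
      rw [hlen hi]
      omega
    · intro i hi k hk
      rw [hL] at hi
      rw [hlen hi] at hk
      rw [hpart hi]
      cases k with
      | zero => simp
      | succ k => exact (Nat.zero_le _).trans_lt (h2 ⟨i, hi⟩ k (by omega)).2
    · intro i hi
      rw [hL] at hi
      have e1 := Finset.mem_Ioc.1 (h1 ⟨i, by omega⟩)
      have e2 := Finset.mem_Ioc.1 (h1 ⟨i + 1, hi⟩)
      rw [hnext i hi] at e1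
      rw [hlen hi, hlen (Nat.lt_of_succ_lt hi)]
      omega
    · intro i hi k hk
      rw [hL] at hi
      rw [hlen hi] at hk
      rw [hpart hi, hpart hi, List.getD_cons_succ]
      exact (h2 ⟨i, hi⟩ k (by omega)).1
    · intro i hi k hk
      rw [hL] at hi
      have e1 := Finset.mem_Ioc.1 (h1 ⟨i, by omega⟩)
      have e2 := Finset.mem_Ioc.1 (h1 ⟨i + 1, hi⟩)
      rw [hnext i hi] at e1
      rw [hlen hi] at hk
      have := (h2 ⟨i, by omega⟩ k (by omega)).2
      rw [hnext i hi] at this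
      rw [hpart hi, hpart (Nat.lt_of_succ_lt hi), List.getD_cons_succ]
      exact this
    · intro i hi
      rw [hL] at hi
      have e1 := Finset.mem_Ioc.1 (h1 ⟨i, hi⟩)
      rw [hlen hi, hpart hi, List.getD_cons_zero]
      omega
    · intro i hi
      rw [hL] at hi
      have e1 := Finset.mem_Ioc.1 (h1 ⟨i, by omega⟩)
      rw [hnext i hi] at e1
      rw [hlen (Nat.lt_of_succ_lt hi), hpart hi, List.getD_cons_zero]
      omega
    · intro i hi k hk
      rw [hL] at hi
      exact (hle i hi k hk).trans (h3 _)

/-- A descending plane partition is determined by its first parts and the rest of its rows. -/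
theorem eq_ofFn_of_isDPP {D : List (List ℕ)} (h : IsDPP D) :
    D = List.ofFn fun i : Fin D.length => (dppPart D i 0 - 1 + 1) :: (D.getD i []).tail := by
  refine List.ext_getElem (by simp) fun i h1 h2 => ?_
  have e1 := h.row_nonempty i h1
  have e2 := h.part_pos i h1 0 e1
  have e : D.getD i [] = D[i] := List.getD_eq_getElem _ _ h1
  simp only [dppRowLen, dppPart, e] at e1 e2
  simp only [List.getElem_ofFn, dppPart, e]
  cases hi : D[i] with
  | nil => simp [hi] at e1
  | cons a l =>
    simp only [hi, List.getD_cons_zero] at e2 ⊢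
    simp only [List.tail_cons, List.cons.injEq, and_true]
    omega

/-- The possible decreasing sequences of `r` first parts, less one, of a descending plane partition
of order `n`. -/
noncomputable def firstParts (n r : ℕ) : Finset (Fin r → ℕ) :=
  open Classical in (Fintype.piFinset fun _ => Finset.range n).filter StrictAnti

theorem mem_firstParts {n r : ℕ} {α : Fin r → ℕ} :
    α ∈ firstParts n r ↔ (∀ i, α i < n) ∧ StrictAnti α := by
  simp [firstParts]

theorem sum_dpp_length_eq {M : Type*} [AddCommMonoid M] (n r : ℕ) (f : List (List ℕ) → M) :
    ∑ D ∈ (finite_dpp n).toFinset with D.length = r, f D =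
      ∑ α ∈ firstParts n r, ∑ l ∈ Fintype.piFinset fun i => Finset.Ioc (nextVal α i) (α i),
        ∑ E ∈ continuations (fun i => α i + 1) fun i => l i - 1,
          f (List.ofFn fun i => (α i + 1) :: E i) := by
  have hs : ∀ α : Fin r → ℕ, ∑ l ∈ Fintype.piFinset fun i => Finset.Ioc (nextVal α i) (α i),
        ∑ E ∈ continuations (fun i => α i + 1) fun i => l i - 1,
          f (List.ofFn fun i => (α i + 1) :: E i) =
      ∑ lE ∈ (Fintype.piFinset fun i => Finset.Ioc (nextVal α i) (α i)).sigma
        fun l => continuations (fun i => α i + 1) fun i => l i - 1,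
          f (List.ofFn fun i => (α i + 1) :: lE.2 i) := fun α => by
    rw [Finset.sum_sigma]
  simp only [hs]
  rw [Finset.sum_sigma']
  symm
  have hlen : ∀ (α : Fin r → ℕ) (l : Fin r → ℕ) (E : Fin r → List ℕ),
      (∀ i, l i ∈ Finset.Ioc (nextVal α i) (α i)) → (∀ i, (E i).length = l i - 1) →
        l = fun i => (E i).length + 1 := by
    intro α l E h1 h2
    funext i
    have := Finset.mem_Ioc.1 (h1 i)
    have := h2 i
    omega
  refine Finset.sum_bij (fun x _ => List.ofFn fun i => (x.1 i + 1) :: x.2.2 i) ?_ ?_ ?_ ?_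
  · rintro ⟨α, l, E⟩ h
    simp only [Finset.mem_sigma, mem_firstParts, Fintype.mem_piFinset, mem_continuations] at h
    obtain ⟨⟨h1, -⟩, h2, h3, h4⟩ := h
    obtain rfl := hlen α l E h2 h4
    simp only [Finset.mem_filter, Set.Finite.mem_toFinset, List.length_ofFn, and_true]
    exact (isDPP_and_hasOrder_iff α E).2 ⟨h2, h3, h1⟩
  · rintro ⟨α, l, E⟩ h ⟨α', l', E'⟩ h' he
    simp only [Finset.mem_sigma, Fintype.mem_piFinset, mem_continuations] at h h'
    obtain rfl := hlen α l E h.2.1 h.2.2.2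
    obtain rfl := hlen α' l' E' h'.2.1 h'.2.2.2
    have := List.ofFn_injective he
    simp only [funext_iff, List.cons.injEq, add_left_inj] at this
    obtain rfl : α = α' := funext fun i => (this i).1
    obtain rfl : E = E' := funext fun i => (this i).2
    rfl
  · intro D hD
    simp only [Finset.mem_filter, Set.Finite.mem_toFinset] at hD
    obtain ⟨hD, rfl⟩ := hD
    have hD : IsDPP D ∧ HasOrder D n := hD
    have e := eq_ofFn_of_isDPP hD.1
    rw [e, isDPP_and_hasOrder_iff (fun i : Fin D.length => dppPart D i 0 - 1)
      (fun i => (D.getD i []).tail)] at hD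
    obtain ⟨h1, h2, h3⟩ := hD
    refine ⟨⟨fun i => dppPart D i 0 - 1, fun i => (D.getD i []).tail.length + 1,
      fun i => (D.getD i []).tail⟩, ?_, e.symm⟩
    simp only [Finset.mem_sigma, mem_firstParts, Fintype.mem_piFinset, mem_continuations]
    refine ⟨⟨h3, ?_⟩, h1, h2, fun i => rfl⟩
    exact strictAnti_of_nextVal_lt
      (fun i => (Finset.mem_Ioc.1 (h1 i)).1.trans_le (Finset.mem_Ioc.1 (h1 i)).2) fun i => le_rfl
  · intro _ _
    rfl

/-- The weight of the rows whose first part is followed by at most `i` parts in total, given that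
the first part is `j + 1`. -/
def dppEntry {R : Type*} [CommRing R] (x y : R) (i j : ℕ) : R :=
  ∑ u ∈ Finset.Ioc 0 i, y * pathWeight x y (u - 1) 1 (j + 1)

/-- For fixed first parts and row lengths the continuations give a determinant; summing over the
lengths, which interlace with `α`, is a second use of `det_sum_Ioc`, now on the row index. -/
theorem sum_dpp_length_eq_sum_det {R : Type*} [CommRing R] (x y : R) (n r : ℕ) :
    ∑ D ∈ (finite_dpp n).toFinset with D.length = r, x ^ specialCount D * y ^ otherCount D =
      ∑ α ∈ firstParts n r, (Matrix.of fun b c => dppEntry x y (α b) (α c)).det := by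
  rw [sum_dpp_length_eq]
  refine Finset.sum_congr rfl fun α hα => ?_
  have hα := (mem_firstParts.1 hα).2
  simp only [dppEntry]
  rw [det_sum_Ioc hα fun c u => y * pathWeight x y (u - 1) 1 (α c + 1)]
  refine Finset.sum_congr rfl fun l hl => ?_
  have hl := fun i => Finset.mem_Ioc.1 (Fintype.mem_piFinset.1 hl i)
  have hla : StrictAnti l := strictAnti_of_nextVal_lt (fun i => (hl i).1) fun i => (hl i).2
  have hE := sum_continuations_eq_det x y n (I := fun i => α i + 1) (l := fun i => l i - 1) 1
    (fun i j hij => by have := hα hij; simpa using this)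
    (fun i j hij => by have := hla hij; have := (hl i).1; have := (hl j).1; simp only; omega)
    (fun i => by
      have := (hl i).1
      have := (hl i).2
      have := (mem_firstParts.1 ‹α ∈ firstParts n r›).1 i
      omega)
  have hdet := Matrix.det_mul_row (fun _ => y)
    (Matrix.of fun c b => pathWeight x y (l b - 1) 1 (α c + 1))
  rw [← hE, ← Matrix.det_transpose] at hdet
  refine Eq.trans ?_ hdet.symm
  rw [Finset.mul_sum]
  refine Finset.sum_congr rfl fun E _ => ?_
  rw [pow_specialCount_mul_pow_otherCount, ← Finset.prod_mul_distrib]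
  -- A first part is positive and in position 0, hence never special: it is the factor `y`.
  simp [rowWeight, partWeight]

theorem sum_firstParts_eq {M : Type*} [AddCommMonoid M] (n r : ℕ) (f : (Fin r → ℕ) → M) :
    ∑ α ∈ firstParts n r, f α =
      ∑ S : {S // S ∈ (Finset.univ : Finset (Fin n)).powersetCard r},
        f fun i => (S.1.orderEmbOfFin (Finset.mem_powersetCard.1 S.2).2 i.rev : Fin n) := by
  symm
  refine Finset.sum_bij (fun S _ i => (S.1.orderEmbOfFin (Finset.mem_powersetCard.1 S.2).2 i.rev :
    Fin n)) ?_ ?_ ?_ ?_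
  · intro S _
    refine mem_firstParts.2 ⟨fun i => Fin.is_lt _, fun i j hij => ?_⟩
    exact Fin.lt_def.1 ((S.1.orderEmbOfFin _).strictMono (Fin.rev_lt_rev.2 hij))
  · intro S _ S' _ h
    apply Subtype.ext
    have h' : (S.1.orderEmbOfFin (Finset.mem_powersetCard.1 S.2).2 : Fin r → Fin n) =
        S'.1.orderEmbOfFin (Finset.mem_powersetCard.1 S'.2).2 := by
      funext i
      have := congrFun h i.rev
      simpa [Fin.rev_rev, ← Fin.ext_iff] using this
    rw [← Finset.coe_inj, ← S.1.range_orderEmbOfFin (Finset.mem_powersetCard.1 S.2).2, h',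
      S'.1.range_orderEmbOfFin (Finset.mem_powersetCard.1 S'.2).2]
  · intro α hα
    obtain ⟨h1, h2⟩ := mem_firstParts.1 hα
    let g : Fin r → Fin n := fun i => ⟨α i.rev, h1 _⟩
    have hg : StrictMono g := fun i j hij => Fin.lt_def.2 (h2 (Fin.rev_lt_rev.2 hij))
    have hS : Finset.univ.image g ∈ (Finset.univ : Finset (Fin n)).powersetCard r := by
      simp [Finset.mem_powersetCard, Finset.card_image_of_injective _ hg.injective]
    refine ⟨⟨_, hS⟩, Finset.mem_univ _, ?_⟩
    have := Finset.orderEmbOfFin_unique (Finset.mem_powersetCard.1 hS).2 (f := g) (by simp) hg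
    funext i
    simp only [← this, g, Fin.rev_rev]
  · intro _ _
    rfl

theorem det_one_add_eq_sum_minors {R : Type*} [CommRing R] {n : ℕ}
    (M : Matrix (Fin n) (Fin n) R) :
    (1 + M).det = ∑ k ∈ Finset.range (n + 1), ∑ S ∈ Finset.univ.powersetCard k,
      (M.submatrix (Subtype.val : S → Fin n) (Subtype.val : S → Fin n)).det := by
  have hd := Polynomial.natDegree_det_X_add_C_le M 1
  have e : (1 + M).det = (1 + (Polynomial.X : Polynomial R) • M.map Polynomial.C).det.eval 1 := by
    rw [← Polynomial.coe_evalRingHom, RingHom.map_det]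
    congr 1
    ext i j
    simp [Matrix.one_apply, apply_ite]
  have e' : (Polynomial.X : Polynomial R) • M.map Polynomial.C +
      (1 : Matrix (Fin n) (Fin n) R).map Polynomial.C =
        1 + (Polynomial.X : Polynomial R) • M.map Polynomial.C := by
    rw [Matrix.map_one _ (map_zero _) (map_one _), add_comm]
  rw [e', Fintype.card_fin] at hd
  rw [e, Polynomial.eval_eq_sum_range' (Nat.lt_succ_of_le hd)]
  simp only [one_pow, mul_one, Matrix.coeff_det_one_add_X_smul_eq_sum_minors]

/-- The first parts form an arbitrary subset of the possible values, so the sum runs over all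
principal minors of the matrix of `dppEntry`. -/
theorem dppPartition_eq_det {R : Type*} [CommRing R] (n : ℕ) (x y : R) :
    dppPartition n x y = (1 + Matrix.of fun i j : Fin n => dppEntry x y i j).det := by
  have hmaps : ∀ D ∈ (finite_dpp n).toFinset, D.length ∈ Finset.range (n + 1) := by
    intro D hD
    have hD : IsDPP D ∧ HasOrder D n := by simpa using hD
    have e := eq_ofFn_of_isDPP hD.1
    rw [e, isDPP_and_hasOrder_iff (fun i : Fin D.length => dppPart D i 0 - 1)
      (fun i => (D.getD i []).tail)] at hD
    obtain ⟨h1, h2, h3⟩ := hD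
    have ha : StrictAnti fun i : Fin D.length => dppPart D i 0 - 1 := strictAnti_of_nextVal_lt
      (fun i => (Finset.mem_Ioc.1 (h1 i)).1.trans_le (Finset.mem_Ioc.1 (h1 i)).2) fun i => le_rfl
    have := Fintype.card_le_of_injective
      (fun i : Fin D.length => (⟨dppPart D i 0 - 1, h3 i⟩ : Fin n))
      fun i j hij => ha.injective (Fin.ext_iff.1 hij)
    simp only [Fintype.card_fin] at this
    exact Finset.mem_range.2 (by omega)
  rw [dppPartition, ← Finset.sum_fiberwise_of_maps_to hmaps, det_one_add_eq_sum_minors]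
  refine Finset.sum_congr rfl fun r _ => ?_
  rw [sum_dpp_length_eq_sum_det, sum_firstParts_eq]
  refine Eq.trans ?_ (Finset.sum_coe_sort (Finset.univ.powersetCard r) _)
  refine Finset.sum_congr rfl fun S _ => ?_
  have hS := (Finset.mem_powersetCard.1 S.2).2
  rw [← Matrix.det_submatrix_equiv_self (Fin.revPerm.trans (S.1.orderIsoOfFin hS).toEquiv)]
  rfl

/-! ### Generating functions for the path weights. -/

section PathWeight

variable {R : Type*} [CommRing R] (x y : R)

/-- All parts are at most `v ≤ k`, hence special at either offset. -/
theorem pathWeight_succ_offset (m k v : ℕ) (h : v ≤ k) :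
    pathWeight x y m (k + 1) v = pathWeight x y m k v := by
  induction m generalizing k v with
  | zero => rfl
  | succ m ih =>
    refine Finset.sum_congr rfl fun u hu => ?_
    have := Finset.mem_Ioc.1 hu
    rw [ih _ _ (by omega), partWeight, partWeight, if_pos (by omega), if_pos (by omega)]

theorem pathWeight_succ_succ (m k v : ℕ) :
    pathWeight x y (m + 1) k (v + 1) =
      pathWeight x y (m + 1) k v + partWeight x y k (v + 1) * pathWeight x y m (k + 1) (v + 1) :=
  Finset.sum_Ioc_succ_top (Nat.zero_le v) _

/-- Combinatorially, if the last part is 1 it is special and contributes `x`; otherwise lowering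
every part and every position by 1 preserves which parts are special. -/
theorem pathWeight_recurrence (m k v : ℕ) (h : k ≤ v) :
    pathWeight x y (m + 1) (k + 1) (v + 1) =
      pathWeight x y (m + 1) k v + x * pathWeight x y m (k + 1) (v + 1) := by
  induction m generalizing k v with
  | zero =>
    induction v, h using Nat.le_induction with
    | base =>
      rw [pathWeight_succ_succ, pathWeight_succ_offset x y _ k k le_rfl, partWeight,
        if_pos le_rfl]
      rfl
    | succ v h ih =>
      rw [pathWeight_succ_succ, ih, pathWeight_succ_succ _ _ _ k, partWeight, partWeight,
        if_neg (by omega), if_neg (by omega)]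
      simp only [pathWeight]
      ring
  | succ m ihm =>
    induction v, h using Nat.le_induction with
    | base =>
      rw [pathWeight_succ_succ, pathWeight_succ_offset x y _ k k le_rfl, partWeight,
        if_pos le_rfl, pathWeight_succ_offset x y _ (k + 1) (k + 1) le_rfl]
    | succ v h ih =>
      have e : ∀ k, k ≤ v + 1 → partWeight x y k (v + 1 + 1) = y := fun k hk => if_neg (by omega)
      have e1 := pathWeight_succ_succ x y (m + 1) (k + 1) (v + 1)
      have e2 := pathWeight_succ_succ x y (m + 1) k v
      have e3 := pathWeight_succ_succ x y m (k + 1) (v + 1)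
      have e4 := ihm (k + 1) (v + 1) (by omega)
      rw [e (k + 1) (by omega)] at e1 e3
      rw [partWeight, if_neg (by omega)] at e2
      linear_combination e1 + ih - e2 - x * e3 + y * e4

theorem pathWeight_one_one (m : ℕ) : pathWeight x y m 1 1 = x ^ m := by
  induction m with
  | zero => simp [pathWeight]
  | succ m ih =>
    rw [pathWeight_succ_succ, pathWeight_succ_offset x y _ 1 1 le_rfl, ih]
    simp [pathWeight, partWeight, pow_succ']

theorem pathWeight_one_succ (m j : ℕ) :
    pathWeight x y (m + 1) 1 (j + 2) - x * pathWeight x y m 1 (j + 2) =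
      pathWeight x y (m + 1) 1 (j + 1) - (x - y) * pathWeight x y m 1 (j + 1) := by
  rw [pathWeight_succ_succ, partWeight, if_neg (by omega)]
  cases m with
  | zero =>
    simp only [pathWeight]
    ring
  | succ m =>
    rw [pathWeight_recurrence x y m 1 (j + 1) (by omega), pathWeight_succ_succ x y m 1 (j + 1),
      partWeight, if_neg (by omega)]
    ring

/-- Generating function of `pathWeight` with respect to the number of parts. -/
noncomputable def pathSeries (j : ℕ) : PowerSeries R :=
  PowerSeries.mk fun k => pathWeight x y k 1 (j + 1)

open PowerSeries

theorem coeff_succ_one_sub_C_mul_X_mul (c : R) (f : PowerSeries R) (k : ℕ) :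
    coeff (k + 1) ((1 - C c * X) * f) = coeff (k + 1) f - c * coeff k f := by
  rw [sub_mul, one_mul, map_sub, mul_assoc, coeff_C_mul, coeff_succ_X_mul]

theorem coeff_zero_one_sub_C_mul_X_mul (c : R) (f : PowerSeries R) :
    coeff 0 ((1 - C c * X) * f) = coeff 0 f := by
  simp

theorem pathSeries_zero : (1 - C x * X) * pathSeries x y 0 = 1 := by
  ext k
  cases k with
  | zero => rw [coeff_zero_one_sub_C_mul_X_mul]; simp [pathSeries, pathWeight]
  | succ k =>
    rw [coeff_succ_one_sub_C_mul_X_mul]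
    simp [pathSeries, pathWeight_one_one, coeff_one, pow_succ']

theorem pathSeries_succ (j : ℕ) :
    (1 - C x * X) * pathSeries x y (j + 1) = (1 - C (x - y) * X) * pathSeries x y j := by
  ext k
  cases k with
  | zero => 
    rw [coeff_zero_one_sub_C_mul_X_mul, coeff_zero_one_sub_C_mul_X_mul]
    simp [pathSeries, pathWeight]
  | succ k =>
    rw [coeff_succ_one_sub_C_mul_X_mul, coeff_succ_one_sub_C_mul_X_mul]
    simp only [pathSeries, coeff_mk]
    exact pathWeight_one_succ x y k j

theorem pow_mul_pathSeries (j : ℕ) :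
    (1 - C x * X) ^ (j + 1) * pathSeries x y j = (1 - C (x - y) * X) ^ j := by
  induction j with
  | zero => simpa using pathSeries_zero x y
  | succ j ih =>
    rw [pow_succ, mul_assoc, pathSeries_succ, mul_left_comm, ih, pow_succ']

/-- Multiplication by a series with constant term 1 acts on coefficients by a lower unitriangular
matrix. -/
theorem det_coeff_mul {n : ℕ} (f : PowerSeries R) (hf : constantCoeff f = 1)
    (g : Fin n → PowerSeries R) :
    (Matrix.of fun k j : Fin n => coeff (k : ℕ) (f * g j)).det =
      (Matrix.of fun k j : Fin n => coeff (k : ℕ) (g j)).det := by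
  let L : Matrix (Fin n) (Fin n) R := Matrix.of fun k i =>
    if (i : ℕ) ≤ k then coeff (k - i : ℕ) f else 0
  have hL : L.det = 1 := by
    rw [Matrix.det_of_isLowerTriangular]
    · simp [L, hf]
    · intro i j hij
      have : (i : ℕ) < j := hij
      simp only [L, Matrix.of_apply]
      rw [if_neg (by omega)]
  have : (Matrix.of fun k j : Fin n => coeff (k : ℕ) (f * g j)) =
      L * Matrix.of fun k j : Fin n => coeff (k : ℕ) (g j) := by
    ext k j
    rw [Matrix.mul_apply, Matrix.of_apply, coeff_mul, Finset.Nat.sum_antidiagonal_eq_sum_range_succ_mk,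
      ← Finset.sum_range_reflect]
    have hk : ∀ i : Fin n, L k i * (Matrix.of fun k j : Fin n => coeff (k : ℕ) (g j)) i j =
        if (i : ℕ) ∈ Finset.range (k + 1) then coeff (k - i : ℕ) f * coeff (i : ℕ) (g j) else 0 := by
      intro i
      simp only [L, Matrix.of_apply, Finset.mem_range, Nat.lt_succ_iff, ite_mul, zero_mul]
    simp only [hk]
    rw [Fin.sum_univ_eq_sum_range (fun i => if i ∈ Finset.range ((k : ℕ) + 1) then
      coeff (k - i : ℕ) f * coeff i (g j) else 0) n, ← Finset.sum_filter]
    have : (Finset.range n).filter (· ∈ Finset.range ((k : ℕ) + 1)) =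
        Finset.range ((k : ℕ) + 1) := by
      ext i
      simp only [Finset.mem_filter, Finset.mem_range]
      omega
    rw [this]
    refine Finset.sum_congr rfl fun i hi => ?_
    have := Finset.mem_range.1 hi
    rw [show (k : ℕ) + 1 - 1 - i = k - i by omega, show (k : ℕ) - (k - i) = i by omega]
  rw [this, Matrix.det_mul, hL, one_mul]

/-- Multiplying the column series of 1 + M by `1 - X` undoes the summation over row lengths. The
columns here are the cumulative sums of the resulting ones, which telescope by `pathSeries_succ`. -/
theorem dppPartition_eq_det_coeff (n : ℕ) :
    dppPartition n x y = (Matrix.of fun k j : Fin n => coeff (k : ℕ)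
      ((1 - C (x - y) * X) * pathSeries x y j - X ^ (j + 1 : ℕ))).det := by
  let d : ℕ → PowerSeries R := fun j => mk fun i => (if i = j then 1 else 0) + dppEntry x y i j
  have hd : ∀ j, (1 - X) * d j = X ^ j - X ^ (j + 1) + C y * X * pathSeries x y j := by
    intro j
    ext k
    rw [show (1 - X : PowerSeries R) = 1 - C 1 * X by simp, mul_assoc (C y), map_add, coeff_C_mul,
      map_sub]
    cases k with
    | zero =>
      rw [coeff_zero_one_sub_C_mul_X_mul]
      simp [d, dppEntry, coeff_X_pow, coeff_zero_X_mul]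
    | succ k =>
      rw [coeff_succ_one_sub_C_mul_X_mul, coeff_succ_X_mul]
      simp only [d, coeff_mk, coeff_X_pow, dppEntry, pathSeries,
        Finset.sum_Ioc_succ_top (Nat.zero_le k), add_left_inj, Nat.add_sub_cancel]
      ring
  have e1 : (1 + Matrix.of fun i j : Fin n => dppEntry x y i j) =
      Matrix.of fun k j : Fin n => coeff (k : ℕ) (d j) := by
    ext i j
    simp [d, Matrix.one_apply, Fin.ext_iff]
  rw [dppPartition_eq_det, e1, ← det_coeff_mul (1 - X) (by simp) fun j : Fin n => d j]
  symm
  cases n with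
  | zero => simp
  | succ n =>
    refine Matrix.det_eq_of_forall_col_eq_smul_add_pred (fun _ => 1) (fun i => ?_) fun i j => ?_
    · simp only [Matrix.of_apply, hd]
      congr 1
      have := pathSeries_zero x y
      simp only [Fin.val_zero, zero_add, pow_zero, pow_one, map_sub]
      linear_combination this
    · simp only [Matrix.of_apply, hd, Fin.val_succ, Fin.val_castSucc, one_mul, ← map_add]
      congr 1
      have := pathSeries_succ x y j
      simp only [map_sub] at this ⊢
      linear_combination this

end PathWeight

/-! ### Comparison of the two determinants. -/

theorem asmPartition_eq_dppPartition_of_field {F : Type*} [Field F] [CharZero F] [IsAlgClosed F]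
    (n : ℕ) (x y : F) : asmPartition n x y = dppPartition n x y := by
  -- The numbers p and q are to have sum `1 + x - y` and product `x`, which is equivalent to pq = x
  -- and (1 - p)(1 - q) = y.
  obtain ⟨p, hp⟩ : ∃ p : F, p * (1 + x - y - p) = x := by
    obtain ⟨p, hp⟩ := IsAlgClosed.exists_root
      (Polynomial.X ^ 2 - Polynomial.C (1 + x - y) * Polynomial.X + Polynomial.C x)
      (by
        have : (Polynomial.X ^ 2 - Polynomial.C (1 + x - y) * Polynomial.X + Polynomial.C x).degree
            = 2 := by compute_degree!
        rw [this]
        decide)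
    refine ⟨p, ?_⟩
    simp only [Polynomial.IsRoot, Polynomial.eval_add, Polynomial.eval_sub, Polynomial.eval_pow,
      Polynomial.eval_mul, Polynomial.eval_X, Polynomial.eval_C] at hp
    linear_combination -hp
  set q := 1 + x - y - p with hq
  have hy : (1 - p) * (1 - q) = y := by rw [hq] at hp ⊢; linear_combination hp
  have hxy : p + q - 1 = x - y := by rw [hq]; ring
  have h1 := dwbcPartition_zero_eq_asmPartition p q n
  have h2 := dwbcPartition_zero_eq_det p q n
  rw [h1] at h2
  rw [hp, hy, hxy] at h2
  -- The factor `(1 - x X) ^ n` clears the denominators `(1 - x X) ^ (j + 1)` of all path series at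
  -- once.
  rw [h2, dppPartition_eq_det_coeff, ← det_coeff_mul ((1 - PowerSeries.C x * PowerSeries.X) ^ n)
    (by simp)]
  congr 1
  ext k j
  simp only [Matrix.of_apply]
  rw [← Polynomial.coeff_coe]
  congr 1
  simp only [Polynomial.coe_sub, Polynomial.coe_mul, Polynomial.coe_pow, Polynomial.coe_one,
    Polynomial.coe_C, Polynomial.coe_X]
  have e : n = (n - 1 - j) + (j + 1) := by omega
  have h := pow_mul_pathSeries x y (j : ℕ)
  have e' : (1 - PowerSeries.C x * PowerSeries.X : PowerSeries F) ^ n =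
      (1 - PowerSeries.C x * PowerSeries.X) ^ (n - 1 - j : ℕ) *
        (1 - PowerSeries.C x * PowerSeries.X) ^ (j + 1 : ℕ) := by
    rw [← pow_add, ← e]
  rw [mul_sub, mul_comm (PowerSeries.X ^ (j + 1 : ℕ)), e', pow_succ (1 - PowerSeries.C (x - y) * _)]
  linear_combination (-(1 - PowerSeries.C x * PowerSeries.X) ^ (n - 1 - j : ℕ) *
    (1 - PowerSeries.C (x - y) * PowerSeries.X)) * h

theorem map_asmPartition {R S : Type*} [CommRing R] [CommRing S] (φ : R →+* S) (n : ℕ) (x y : R) :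
    φ (asmPartition n x y) = asmPartition n (φ x) (φ y) := by
  simp [asmPartition]

theorem map_dppPartition {R S : Type*} [CommRing R] [CommRing S] (φ : R →+* S) (n : ℕ) (x y : R) :
    φ (dppPartition n x y) = dppPartition n (φ x) (φ y) := by
  simp [dppPartition]

theorem mainTheorem1 {R : Type*} [CommRing R] (n : ℕ) (x y : R) :
    asmPartition n x y = dppPartition n x y := by
  have h : asmPartition n (MvPolynomial.X 0 : MvPolynomial (Fin 2) ℤ) (MvPolynomial.X 1) =
      dppPartition n (MvPolynomial.X 0) (MvPolynomial.X 1) := by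
    -- The identity in two indeterminates over ℤ may be checked at all points of ℂ².
    apply MvPolynomial.map_injective (Int.castRingHom ℂ) Int.cast_injective
    apply MvPolynomial.funext
    intro v
    rw [map_asmPartition, map_asmPartition, map_dppPartition, map_dppPartition]
    exact asmPartition_eq_dppPartition_of_field n _ _
  have := congrArg (MvPolynomial.eval₂Hom (Int.castRingHom R) ![x, y]) h
  rw [map_asmPartition, map_dppPartition] at this
  simpa using this
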